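/- **Conventions.** Let $P$ be a poset. A net in $P$ is a family $(x_\gamma)_{\gamma\in\Gamma}$ indexed by a nonempty directed set $\Gamma$; it is increasing (decreasing) if $\gamma_1\le\gamma_2$ implies $x_{\gamma_1}\le x_{\gamma_2}$ (respectively $x_{\gamma_1}\ge x_{\gamma_2}$). A net $(x_\gamma)_{\gamma\in\Gamma}$ *order converges* to $x\in P$ if there are nets $(y_\gamma)_{\gamma\in\Gamma}$, $(z_\gamma)_{\gamma\in\Gamma}$ with $y_\gamma\le x_\gamma\le z_\gamma$ for all $\gamma$, $(y_\gamma)$ increasing with $\bigvee_\gamma y_\gamma=x$, and $(z_\gamma)$ decreasing with $\bigwedge_\gamma z_\gamma=x$. The *order topology* $\tau_o(P)$ (respectively the *sequential order topology* $\tau_{os}(P)$) is the topology whose closed sets are the sets $X\subseteq P$ such that no net (respectively no sequence) in $X$ order converges to a point outside $X$. $P$ is *monotone order separable* if for every increasing net $(x_\gamma)_{\gamma\in\Gamma}$ in $P$ that has a supremum there is an increasing sequence $(\gamma_n)_{n\in\mathbb N}$ in $\Gamma$ with $\bigvee_n x_{\gamma_n}=\bigvee_\gamma x_\gamma$, and for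 every decreasing net $(x_\gamma)_{\gamma\in\Gamma}$ in $P$ that has an infimum there is an increasing sequence $(\gamma_n)_{n\in\mathbb N}$ in $\Gamma$ with $\bigwedge_n x_{\gamma_n}=\bigwedge_\gamma x_\gamma$. For a (complex, not necessarily unital) C*-algebra $\mathcal A$ with dual space $\mathcal A^*$, let $\mathcal A^*_s=\{\varphi\in\mathcal A^*:\varphi(x)\in\mathbb R\text{ for all }x=x^*\in\mathcal A\}$, ordered by $\varphi\le\psi$ iff $\varphi(x)\le\psi(x)$ for every positive $x\in\mathcal A$ (that is, every $x=a^*a$ with $a\in\mathcal A$). A von Neumann algebra is a unital C*-algebra $\mathcal M$ that is isometrically the dual of a Banach space $X$; its predual $\mathcal M_*\subseteq\mathcal M^*$ is the space of the functionals on $\mathcal M$ given by evaluation at the points of $X$, and $\mathcal M_*^s=\mathcal M_*\cap\mathcal M^*_s$ carries the order of $\mathcal M^*_s$. On all these spaces $\tau_{\|\cdot\|}$ denotes the topology of the dual norm. **Theorem.** For every von Neumann algebra $\mathcal M$, $$\tau_{\|\cdot\|}(\mathcal M_*^s)=\tau_o(\mathcal M_*^s)=\tau_{os}(\mathcal M_*^s),$$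 and $\mathcal M_*^s$ is monotone order separable. **Corollary.** For every C*-algebra $\mathcal A$, $$\tau_{\|\cdot\|}(\mathcal A^*_s)=\tau_o(\mathcal A^*_s)=\tau_{os}(\mathcal A^*_s),$$ and $\mathcal A^*_s$ is monotone order separable. -/

import Mathlib

universe u v w

/-! ### Order convergence and order topologies on a poset -/

/-- A net `x : Γ → P` order converges to `p` if there are nets `y`, `z` on the same index set with
`y γ ≤ x γ ≤ z γ` for all `γ`, `y` increasing with supremum `p` and `z` decreasing with
infimum `p`. -/
def OrderConverges {P : Type*} [PartialOrder P] {Γ : Type*} [Preorder Γ] (x : Γ → P) (p : P) :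
    Prop :=
  ∃ y z : Γ → P, (∀ γ, y γ ≤ x γ ∧ x γ ≤ z γ) ∧
    (Monotone y ∧ IsLUB (Set.range y) p) ∧ (Antitone z ∧ IsGLB (Set.range z) p)

/-- A set `X` is order-closed if no net in `X` order converges to a point outside `X`.  Nets are
indexed by nonempty directed sets.  It is enough to let these range over the universe of `P`: a
witness `(x, y, z)` over any `Γ` may be reindexed by the set of triples `(x γ, y γ, z γ)`, directed
by `y ≤ y'` and `z' ≤ z`. -/
def IsOrderClosed {P : Type u} [PartialOrder P] (X : Set P) : Prop :=
  ∀ (Γ : Type u) [Preorder Γ] [Nonempty Γ] [IsDirectedOrder Γ] (x : Γ → P) (p : P),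
    (∀ γ, x γ ∈ X) → OrderConverges x p → p ∈ X

/-- A set `X` is sequentially order-closed if no sequence in `X` order converges to a point
outside `X`. -/
def IsSeqOrderClosed {P : Type u} [PartialOrder P] (X : Set P) : Prop :=
  ∀ (x : ℕ → P) (p : P), (∀ n, x n ∈ X) → OrderConverges x p → p ∈ X

/-- Order convergence passes to cofinal monotone reindexings. -/
theorem OrderConverges.comp_cofinal {P : Type*} [PartialOrder P] {Γ Δ : Type*} [Preorder Γ]
    [Preorder Δ] {x : Γ → P} {p : P} (h : OrderConverges x p) (i : Δ → Γ) (hi : Monotone i)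
    (hc : ∀ γ, ∃ δ, γ ≤ i δ) : OrderConverges (x ∘ i) p := by
  obtain ⟨y, z, hyz, ⟨hy, hyl⟩, hz, hzg⟩ := h
  refine ⟨y ∘ i, z ∘ i, fun δ => hyz (i δ), ⟨hy.comp hi, ?_, ?_⟩, hz.comp_monotone hi, ?_, ?_⟩
  · rintro _ ⟨δ, rfl⟩
    exact hyl.1 ⟨i δ, rfl⟩
  · intro b hb
    refine hyl.2 ?_
    rintro _ ⟨γ, rfl⟩
    obtain ⟨δ, hδ⟩ := hc γ
    exact (hy hδ).trans (hb ⟨δ, rfl⟩)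
  · rintro _ ⟨δ, rfl⟩
    exact hzg.1 ⟨i δ, rfl⟩
  · intro b hb
    refine hzg.2 ?_
    rintro _ ⟨γ, rfl⟩
    obtain ⟨δ, hδ⟩ := hc γ
    exact (hb ⟨δ, rfl⟩).trans (hz hδ)

theorem IsOrderClosed.union {P : Type u} [PartialOrder P] {A B : Set P} (hA : IsOrderClosed A)
    (hB : IsOrderClosed B) : IsOrderClosed (A ∪ B) := by
  intro Γ _ _ _ x p hx hp
  by_cases h : ∀ γ, ∃ δ, γ ≤ δ ∧ x δ ∈ A
  · left
    have : Nonempty {δ // x δ ∈ A} :=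
      let ⟨δ, _, hδ⟩ := h (Classical.arbitrary Γ); ⟨⟨δ, hδ⟩⟩
    have : IsDirectedOrder {δ // x δ ∈ A} := ⟨fun a b => by
      obtain ⟨c, hac, hbc⟩ := exists_ge_ge a.1 b.1
      obtain ⟨d, hcd, hd⟩ := h c
      exact ⟨⟨d, hd⟩, hac.trans hcd, hbc.trans hcd⟩⟩
    exact hA {δ // x δ ∈ A} (x ∘ Subtype.val) p (fun γ => γ.2)
      (hp.comp_cofinal Subtype.val (fun _ _ h => h)
        (fun γ => let ⟨δ, h1, h2⟩ := h γ; ⟨⟨δ, h2⟩, h1⟩))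
  · right
    push Not at h
    obtain ⟨γ, hγ⟩ := h
    have : Nonempty {δ // γ ≤ δ} := ⟨⟨γ, le_rfl⟩⟩
    have : IsDirectedOrder {δ // γ ≤ δ} := ⟨fun a b => by
      obtain ⟨c, hac, hbc⟩ := exists_ge_ge a.1 b.1
      exact ⟨⟨c, a.2.trans hac⟩, hac, hbc⟩⟩
    exact hB {δ // γ ≤ δ} (x ∘ Subtype.val) p (fun δ => (hx δ.1).resolve_left (hγ _ δ.2))
      (hp.comp_cofinal Subtype.val (fun _ _ h => h)
        (fun δ => let ⟨c, h1, h2⟩ := exists_ge_ge γ δ; ⟨⟨c, h1⟩, h2⟩))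

theorem IsSeqOrderClosed.union {P : Type u} [PartialOrder P] {A B : Set P}
    (hA : IsSeqOrderClosed A) (hB : IsSeqOrderClosed B) : IsSeqOrderClosed (A ∪ B) := by
  intro x p hx hp
  by_cases h : ∀ n, ∃ m, n < m ∧ x m ∈ A
  · left
    obtain ⟨φ, hφ, hφA⟩ := Filter.extraction_of_frequently_atTop
      (Filter.frequently_atTop'.mpr h)
    exact hA (x ∘ φ) p hφA (hp.comp_cofinal φ hφ.monotone fun n => ⟨n, hφ.id_le n⟩)
  · right
    push Not at h
    obtain ⟨n, hn⟩ := h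
    exact hB (x ∘ fun m => m + (n + 1)) p
      (fun m => (hx _).resolve_left (hn (m + (n + 1)) (by omega)))
      (hp.comp_cofinal _ (fun a b hab => by simpa using hab) fun m => ⟨m, Nat.le_add_right _ _⟩)

/-- The order topology of a poset: its closed sets are exactly the order-closed sets. -/
@[reducible] def netOrderTopology (P : Type u) [PartialOrder P] : TopologicalSpace P :=
  TopologicalSpace.ofClosed {X | IsOrderClosed X}
    (fun _ _ _ _ _ _ hx _ => (hx (Classical.arbitrary _)).elim)
    (fun _ hS Γ _ _ _ x p hx hp X hX => hS hX Γ x p (fun γ => hx γ X hX) hp)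
    (fun _ hA _ hB => hA.union hB)

/-- The sequential order topology of a poset: its closed sets are exactly the sequentially
order-closed sets. -/
@[reducible] def seqOrderTopology (P : Type u) [PartialOrder P] : TopologicalSpace P :=
  TopologicalSpace.ofClosed {X | IsSeqOrderClosed X}
    (fun _ _ hx _ => (hx 0).elim)
    (fun _ hS x p hx hp X hX => hS hX x p (fun n => hx n X hX) hp)
    (fun _ hA _ hB => hA.union hB)

/-- `P` is monotone order separable if every increasing (decreasing) net that has a supremum
(infimum) has the same supremum (infimum) along some increasing sequence of indices (so along an increasing,
respectively decreasing, sequence of terms).  As above, the universe of `P` suffices for the index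
sets: a net over any `Γ` may be reindexed by its range. -/
def MonotoneOrderSeparable (P : Type u) [PartialOrder P] : Prop :=
  ∀ (Γ : Type u) [Preorder Γ] [Nonempty Γ] [IsDirectedOrder Γ] (x : Γ → P) (p : P),
    (Monotone x → IsLUB (Set.range x) p →
      ∃ γ : ℕ → Γ, Monotone γ ∧ IsLUB (Set.range fun n => x (γ n)) p) ∧
    (Antitone x → IsGLB (Set.range x) p →
      ∃ γ : ℕ → Γ, Monotone γ ∧ IsGLB (Set.range fun n => x (γ n)) p)

/-! ### Hermitian functionals on C*-algebras -/

/-- The hermitian part `{f ∈ S | f a ∈ ℝ for all a = a*}` of a space `S` of bounded functionals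
on the C*-algebra `A`. -/
def HermitianPart {A : Type u} [NonUnitalCStarAlgebra A] (S : Submodule ℂ (StrongDual ℂ A)) :
    Type u :=
  {f : StrongDual ℂ A // f ∈ S ∧ ∀ a : A, IsSelfAdjoint a → (f a).im = 0}

/-- A bounded functional is determined by its values on the positive elements `a* a`. -/
theorem strongDual_ext_of_star_mul_self {A : Type u} [NonUnitalCStarAlgebra A]
    {f g : StrongDual ℂ A} (h : ∀ a : A, f (star a * a) = g (star a * a)) : f = g := by
  let _ := CStarAlgebra.spectralOrder A
  let _ := CStarAlgebra.spectralOrderedRing A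
  have key : (f : A →ₗ[ℂ] ℂ) = g := by
    refine LinearMap.ext_on (CStarAlgebra.span_nonneg (A := A)) ?_
    intro a ha
    have ha' : 0 ≤ a := ha
    obtain ⟨b, rfl⟩ := CStarAlgebra.nonneg_iff_eq_star_mul_self.mp ha'
    exact h b
  exact ContinuousLinearMap.coe_injective key

/-- The order of the hermitian part: `f ≤ g` iff `f x ≤ g x` for all positive elements
`x = a* a` (both values are real since `x` is self-adjoint). -/
instance HermitianPart.instPartialOrder {A : Type u} [NonUnitalCStarAlgebra A]
    (S : Submodule ℂ (StrongDual ℂ A)) : PartialOrder (HermitianPart S) where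
  le f g := ∀ a : A, (f.1 (star a * a)).re ≤ (g.1 (star a * a)).re
  le_refl _ _ := le_rfl
  le_trans _ _ _ h₁ h₂ a := (h₁ a).trans (h₂ a)
  le_antisymm f g h₁ h₂ := Subtype.ext <| strongDual_ext_of_star_mul_self fun a =>
    Complex.ext (le_antisymm (h₁ a) (h₂ a)) <| by
      rw [f.2.2 _ (IsSelfAdjoint.star_mul_self a), g.2.2 _ (IsSelfAdjoint.star_mul_self a)]

/-- The metric `‖f - g‖` on the hermitian part given by the dual (operator) norm. -/
noncomputable instance HermitianPart.instMetricSpace {A : Type u} [NonUnitalCStarAlgebra A]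
    (S : Submodule ℂ (StrongDual ℂ A)) : MetricSpace (HermitianPart S) :=
  MetricSpace.induced Subtype.val Subtype.val_injective inferInstance

/-- The norm topology of the hermitian part. -/
@[reducible] noncomputable def normTopology {A : Type u} [NonUnitalCStarAlgebra A]
    (S : Submodule ℂ (StrongDual ℂ A)) : TopologicalSpace (HermitianPart S) :=
  (HermitianPart.instMetricSpace S).toUniformSpace.toTopologicalSpace

/-- A von Neumann algebra is a C*-algebra `M` that is (isometrically, through `e`) the dual of a
Banach space `X`.  This is the predual `M_*`, as the space of those functionals on `M`, called
normal, that are evaluations at points of `X`. -/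
noncomputable def vonNeumannPredual {M : Type u} [CStarAlgebra M] {X : Type v}
    [NormedAddCommGroup X] [NormedSpace ℂ X] (e : StrongDual ℂ X ≃ₗᵢ[ℂ] M) :
    Submodule ℂ (StrongDual ℂ M) where
  carrier := {f | ∃ x : X, ∀ φ : StrongDual ℂ X, f (e φ) = φ x}
  zero_mem' := ⟨0, fun φ => by simp⟩
  add_mem' := by
    rintro f g ⟨x, hx⟩ ⟨y, hy⟩
    exact ⟨x + y, fun φ => by simp [hx, hy]⟩
  smul_mem' := by
    rintro c f ⟨x, hx⟩
    exact ⟨c • x, fun φ => by simp [hx]⟩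

/-!
The three topologies agree as soon as two facts hold for a norm-closed space `S` of functionals.

* Monotone nets that have a supremum (or infimum) in the hermitian part of `S` converge to it in
  norm. A positive functional has norm comparable to its mass, the supremum over the positive part
  of the open unit ball; that part is directed, so the mass is superadditive, and a decreasing net
  of positive functionals is Cauchy because its masses converge. Hence order convergence of nets
  implies norm convergence (`OrderConverges.tendsto`), and monotone order separability follows
  because a norm limit is attained along a sequence (`monotoneOrderSeparable_hermitianPart`).
* Every hermitian `φ ∈ S` is dominated by a positive `p ∈ S` with `‖p‖ ≤ C * ‖φ‖`
  (`HasPositiveDomination`). Then a sequence that converges fast in norm is squeezed in order by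
  the tails of a convergent series of positive functionals (`orderConverges_of_dist_le`), so
  sequentially order-closed sets are norm closed.

Domination is a separation argument. In the whole dual of a C*-algebra it is one application of the
Hahn-Banach theorem to an open convex set (`hasPositiveDomination_top`). In the predual of a von
Neumann algebra the separating functional has to be normal, so the separation takes place in the
weak-* topology, between a compact convex set and a ray. This requires that the positive part of
a ball be weak-* compact: an element `a` is self-adjoint of norm at most `r` iff
`‖a + i t‖ ≤ √(r² + t²)` for all real `t`, so these elements form an intersection of balls. The
functional obtained dominates only up to an error, because the positive cone is cut off at a finite
radius; a geometric iteration removes the error (`hasPositiveDomination_vonNeumannPredual`).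

Separation yields a normal functional whose hermitian part must be normal too, that is, the predual
is closed under the adjoint operation (`conjStar_mem_vonNeumannPredual`). A functional on the dual
of a Banach space `X` is evaluation at a point of `X` if it is small on those unit vectors that
vanish at suitable finitely many points (`exists_eq_inclusionInDoubleDual_of_small`), and
compactness of the self-adjoint part of the unit ball verifies this for the adjoint of a normal functional.
-/

open Filter Topology

/-! ### Positive functionals and monotone nets -/

/-- The real subspace of hermitian functionals: those with real values at self-adjoint elements. -/
def hermitianFunctionals (A : Type*) [NonUnitalCStarAlgebra A] :
    Submodule ℝ (StrongDual ℂ A) where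
  carrier := {f | ∀ a : A, IsSelfAdjoint a → (f a).im = 0}
  zero_mem' := by simp
  add_mem' := by
    intro f g hf hg a ha
    simp [hf a ha, hg a ha]
  smul_mem' := by
    intro c f hf a ha
    simp [hf a ha]

section Nonunital

variable {A : Type u} [NonUnitalCStarAlgebra A]

theorem mem_hermitianFunctionals {f : StrongDual ℂ A} :
    f ∈ hermitianFunctionals A ↔ ∀ a : A, IsSelfAdjoint a → (f a).im = 0 := Iff.rfl

theorem isClosed_hermitianFunctionals :
    IsClosed (hermitianFunctionals A : Set (StrongDual ℂ A)) := by
  have : (hermitianFunctionals A : Set (StrongDual ℂ A)) =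
      ⋂ (a : A) (_ : IsSelfAdjoint a), {f | (f a).im = 0} := by
    ext f
    simp [mem_hermitianFunctionals]
  rw [this]
  refine isClosed_iInter fun a => isClosed_iInter fun _ => isClosed_eq ?_ continuous_const
  fun_prop

/-- The hermitian functionals in `S`, as a real subspace of the dual. -/
noncomputable def Submodule.hermitian (S : Submodule ℂ (StrongDual ℂ A)) :
    Submodule ℝ (StrongDual ℂ A) :=
  S.restrictScalars ℝ ⊓ hermitianFunctionals A

namespace HermitianPart

variable {S : Submodule ℂ (StrongDual ℂ A)}

/-- An element of the hermitian part, from a member of the real subspace. -/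
noncomputable def ofMem {f : StrongDual ℂ A} (hf : f ∈ S.hermitian) : HermitianPart S :=
  Subtype.mk f hf

@[simp]
theorem val_ofMem {f : StrongDual ℂ A} (hf : f ∈ S.hermitian) : (ofMem hf).1 = f := rfl

theorem val_mem (f : HermitianPart S) : f.1 ∈ S.hermitian := f.2

theorem dist_eq_norm (f g : HermitianPart S) : dist f g = ‖f.1 - g.1‖ :=
  _root_.dist_eq_norm f.1 g.1

theorem tendsto_iff {ι : Type*} {l : Filter ι} {x : ι → HermitianPart S} {p : HermitianPart S} :
    Tendsto x l (𝓝 p) ↔ Tendsto (fun i => (x i).1 - p.1) l (𝓝 0) := by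
  rw [tendsto_iff_dist_tendsto_zero, tendsto_zero_iff_norm_tendsto_zero (E := StrongDual ℂ A)]
  simp only [HermitianPart.dist_eq_norm]

end HermitianPart

theorem Submodule.isClosed_hermitian {S : Submodule ℂ (StrongDual ℂ A)}
    (hS : IsClosed (S : Set (StrongDual ℂ A))) :
    IsClosed (S.hermitian : Set (StrongDual ℂ A)) :=
  hS.inter isClosed_hermitianFunctionals

theorem norm_apply_eq_abs_re {f : StrongDual ℂ A} (hf : f ∈ hermitianFunctionals A) {a : A}
    (ha : IsSelfAdjoint a) : ‖f a‖ = |(f a).re| :=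
  (Complex.abs_re_eq_norm.mpr (hf a ha)).symm

theorem abs_re_apply_le (f : StrongDual ℂ A) (a : A) : |(f a).re| ≤ ‖f‖ * ‖a‖ :=
  (Complex.abs_re_le_norm _).trans (f.le_opNorm a)

variable [PartialOrder A]

/-- The mass of a functional: its supremum over the positive part of the open unit ball. -/
noncomputable def positiveMass (f : StrongDual ℂ A) : ℝ :=
  sSup ((fun a : A => (f a).re) '' ({a | 0 ≤ a} ∩ Metric.ball 0 1))

theorem re_apply_le_positiveMass (f : StrongDual ℂ A) {a : A} (ha : 0 ≤ a) (ha1 : ‖a‖ < 1) :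
    (f a).re ≤ positiveMass f := by
  refine le_csSup ⟨‖f‖, ?_⟩ ⟨a, ⟨ha, by simpa using ha1⟩, rfl⟩
  rintro _ ⟨b, ⟨-, hb⟩, rfl⟩
  rw [mem_ball_zero_iff] at hb
  exact (le_abs_self _).trans <| (abs_re_apply_le f b).trans <|
    mul_le_of_le_one_right (norm_nonneg _) hb.le

theorem positiveMass_nonneg (f : StrongDual ℂ A) : 0 ≤ positiveMass f := by
  simpa using re_apply_le_positiveMass f le_rfl (by simp)

variable [StarOrderedRing A]

theorem HermitianPart.le_iff {S : Submodule ℂ (StrongDual ℂ A)} {f g : HermitianPart S} :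
    f ≤ g ↔ ∀ a : A, 0 ≤ a → (f.1 a).re ≤ (g.1 a).re := by
  constructor
  · intro h a ha
    obtain ⟨b, rfl⟩ := CStarAlgebra.nonneg_iff_eq_star_mul_self.mp ha
    exact h b
  · intro h a
    exact h _ (star_mul_self_nonneg a)

/-- Positive elements span with norm control, so the values on them bound the norm of a
hermitian functional. -/
theorem norm_le_of_forall_nonneg {f : StrongDual ℂ A} (hf : f ∈ hermitianFunctionals A) {r : ℝ}
    (hr : 0 ≤ r) (h : ∀ a : A, 0 ≤ a → |(f a).re| ≤ r * ‖a‖) : ‖f‖ ≤ 4 * r := by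
  refine f.opNorm_le_bound (by positivity) fun a => ?_
  obtain ⟨x, hx0, hxa, hx⟩ := CStarAlgebra.exists_sum_four_nonneg a
  calc ‖f a‖ = ‖∑ i : Fin 4, Complex.I ^ (i : ℕ) • f (x i)‖ := by
        conv_lhs => rw [hx]
        simp only [map_sum, map_smul]
    _ ≤ ∑ i : Fin 4, ‖Complex.I ^ (i : ℕ) • f (x i)‖ := norm_sum_le _ _
    _ ≤ ∑ _i : Fin 4, r * ‖a‖ := by
        refine Finset.sum_le_sum fun i _ => ?_
        rw [norm_smul, norm_pow, Complex.norm_I, one_pow, one_mul,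
          norm_apply_eq_abs_re hf (hx0 i).isSelfAdjoint]
        exact (h _ (hx0 i)).trans (mul_le_mul_of_nonneg_left (hxa i) hr)
    _ = 4 * r * ‖a‖ := by simp; ring

theorem norm_le_positiveMass {f : StrongDual ℂ A} (hf : f ∈ hermitianFunctionals A)
    (hp : ∀ a : A, 0 ≤ a → 0 ≤ (f a).re) : ‖f‖ ≤ 4 * positiveMass f := by
  refine norm_le_of_forall_nonneg hf (positiveMass_nonneg f) fun a ha => ?_
  rw [abs_of_nonneg (hp a ha)]
  have key : ∀ t > ‖a‖, (f a).re ≤ positiveMass f * t := by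
    intro t ht
    have ht0 : 0 < t := (norm_nonneg a).trans_lt ht
    have h1 := re_apply_le_positiveMass f (a := (t⁻¹ : ℝ) • a)
      (smul_nonneg (by positivity) ha) (by
        rw [norm_smul, Real.norm_of_nonneg (by positivity), inv_mul_lt_one₀ ht0]
        exact ht)
    have h2 : f ((t⁻¹ : ℝ) • a) = (t⁻¹ : ℝ) • f a := map_real_smul f f.continuous _ _
    rw [h2, Complex.real_smul, Complex.re_ofReal_mul, inv_mul_le_iff₀ ht0] at h1
    linarith
  refine ge_of_tendsto (x := 𝓝[>] ‖a‖) (f := fun t => positiveMass f * t) ?_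
    (eventually_nhdsWithin_of_forall key)
  exact (tendsto_nhdsWithin_of_tendsto_nhds (by exact (continuous_const_mul _).tendsto _))

/-- The mass is superadditive on positive functionals because the positive part of the open unit
ball is directed. -/
theorem positiveMass_add_le {f g : StrongDual ℂ A} (hf : ∀ a : A, 0 ≤ a → 0 ≤ (f a).re)
    (hg : ∀ a : A, 0 ≤ a → 0 ≤ (g a).re) :
    positiveMass f + positiveMass g ≤ positiveMass (f + g) := by
  have hne : ∀ f : StrongDual ℂ A,
      ((fun a : A => (f a).re) '' ({a | 0 ≤ a} ∩ Metric.ball 0 1)).Nonempty :=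
    fun f => ⟨_, 0, ⟨le_rfl, by simp⟩, rfl⟩
  have mono : ∀ f : StrongDual ℂ A, (∀ a : A, 0 ≤ a → 0 ≤ (f a).re) → ∀ a b : A, a ≤ b →
      (f a).re ≤ (f b).re := by
    intro f hf a b hab
    have := hf (b - a) (sub_nonneg.mpr hab)
    rw [map_sub, Complex.sub_re] at this
    linarith
  rw [← le_sub_iff_add_le]
  refine csSup_le (hne f) ?_
  rintro _ ⟨a, ha, rfl⟩
  dsimp only
  rw [le_sub_comm]
  refine csSup_le (hne g) ?_
  rintro _ ⟨b, hb, rfl⟩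
  obtain ⟨c, hc, hac, hbc⟩ := CStarAlgebra.directedOn_nonneg_ball a ha b hb
  have h1 := re_apply_le_positiveMass (f + g) hc.1 (by simpa using hc.2)
  have h2 := mono f hf a c hac
  have h3 := mono g hg b c hbc
  rw [add_apply, Complex.add_re] at h1
  dsimp only
  linarith

/-- A decreasing net of positive functionals converges in norm. -/
theorem exists_tendsto_of_antitone_nonneg {Γ : Type*} [Preorder Γ] [Nonempty Γ]
    [IsDirectedOrder Γ] (x : Γ → StrongDual ℂ A) (hx : ∀ γ, x γ ∈ hermitianFunctionals A)
    (hpos : ∀ γ, ∀ a : A, 0 ≤ a → 0 ≤ (x γ a).re)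
    (hanti : ∀ γ δ, γ ≤ δ → ∀ a : A, 0 ≤ a → (x δ a).re ≤ (x γ a).re) :
    ∃ f, Tendsto x atTop (𝓝 f) := by
  have hdiff : ∀ γ δ, γ ≤ δ → ∀ a : A, 0 ≤ a → 0 ≤ ((x γ - x δ) a).re := by
    intro γ δ h a ha
    simpa using hanti γ δ h a ha
  have hmass : ∀ γ δ, γ ≤ δ →
      positiveMass (x γ - x δ) + positiveMass (x δ) ≤ positiveMass (x γ) := by
    intro γ δ h
    simpa using positiveMass_add_le (hdiff γ δ h) (hpos δ)
  have hnorm : ∀ γ δ, γ ≤ δ → ‖x γ - x δ‖ ≤ 4 * (positiveMass (x γ) - positiveMass (x δ)) := by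
    intro γ δ h
    have h1 := norm_le_positiveMass (sub_mem (hx γ) (hx δ)) (hdiff γ δ h)
    have h2 := hmass γ δ h
    linarith
  have hbdd : BddBelow (Set.range fun γ => positiveMass (x γ)) :=
    ⟨0, by rintro _ ⟨γ, rfl⟩; exact positiveMass_nonneg _⟩
  have hcauchy : Cauchy (map x atTop) := by
    refine Metric.cauchy_iff.mpr ⟨inferInstance, fun ε hε => ?_⟩
    obtain ⟨γ, hγ⟩ := exists_lt_of_ciInf_lt
      (lt_add_of_pos_right (⨅ γ, positiveMass (x γ)) (show 0 < ε / 8 by positivity))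
    have hnear : ∀ δ, γ ≤ δ → dist (x γ) (x δ) < ε / 2 := by
      intro δ h
      have h1 := hnorm γ δ h
      have h2 := ciInf_le hbdd δ
      rw [dist_eq_norm]
      linarith
    refine ⟨x '' Set.Ici γ, image_mem_map (Ici_mem_atTop γ), ?_⟩
    rintro _ ⟨δ, hδ, rfl⟩ _ ⟨δ', hδ', rfl⟩
    have h1 := hnear δ hδ
    have h2 := hnear δ' hδ'
    have h3 := dist_triangle_left (x δ) (x δ') (x γ)
    linarith
  exact CompleteSpace.complete hcauchy

/-- A decreasing net of positive functionals in a closed space of hermitian functionals, with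
infimum zero there, converges to zero in norm. -/
theorem tendsto_zero_of_antitone_nonneg {T : Submodule ℝ (StrongDual ℂ A)}
    (hT : IsClosed (T : Set (StrongDual ℂ A))) (hTh : T ≤ hermitianFunctionals A)
    {Γ : Type*} [Preorder Γ] [Nonempty Γ]
    [IsDirectedOrder Γ] (x : Γ → StrongDual ℂ A) (hx : ∀ γ, x γ ∈ T)
    (hpos : ∀ γ, ∀ a : A, 0 ≤ a → 0 ≤ (x γ a).re)
    (hanti : ∀ γ δ, γ ≤ δ → ∀ a : A, 0 ≤ a → (x δ a).re ≤ (x γ a).re)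
    (hinf : ∀ f ∈ T, (∀ γ, ∀ a : A, 0 ≤ a → (f a).re ≤ (x γ a).re) →
      ∀ a : A, 0 ≤ a → (f a).re ≤ 0) :
    Tendsto x atTop (𝓝 0) := by
  obtain ⟨f, hf⟩ := exists_tendsto_of_antitone_nonneg x (fun γ => hTh (hx γ)) hpos hanti
  have hfT : f ∈ T := hT.mem_of_tendsto hf (Eventually.of_forall hx)
  have heval : ∀ a : A, Tendsto (fun γ => (x γ a).re) atTop (𝓝 (f a).re) := by
    intro a
    have hc : Continuous fun g : StrongDual ℂ A => (g a).re := by fun_prop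
    exact (hc.tendsto f).comp hf
  have hf0 : ∀ a : A, 0 ≤ a → 0 ≤ (f a).re := fun a ha =>
    ge_of_tendsto (heval a) (Eventually.of_forall fun γ => hpos γ a ha)
  have hf1 := hinf f hfT fun γ a ha =>
    le_of_tendsto (heval a) ((eventually_ge_atTop γ).mono fun δ h => hanti γ δ h a ha)
  have : ‖f‖ ≤ 4 * 0 := norm_le_of_forall_nonneg (hTh hfT) le_rfl fun a ha => by
    rw [le_antisymm (hf1 a ha) (hf0 a ha)]
    simp
  rw [mul_zero, norm_le_zero_iff] at this
  rwa [this] at hf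

variable {S : Submodule ℂ (StrongDual ℂ A)}

theorem HermitianPart.tendsto_of_monotone_isLUB (hS : IsClosed (S : Set (StrongDual ℂ A)))
    {Γ : Type*} [Preorder Γ] [Nonempty Γ] [IsDirectedOrder Γ] {y : Γ → HermitianPart S}
    {p : HermitianPart S} (hy : Monotone y) (hp : IsLUB (Set.range y) p) :
    Tendsto y atTop (𝓝 p) := by
  rw [HermitianPart.tendsto_iff, ← tendsto_neg_iff]
  simp only [neg_sub, neg_zero]
  refine tendsto_zero_of_antitone_nonneg (Submodule.isClosed_hermitian hS) inf_le_right _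
    (fun γ => sub_mem p.val_mem (y γ).val_mem) ?_ ?_ ?_
  · intro γ a ha
    simpa using HermitianPart.le_iff.mp (hp.1 ⟨γ, rfl⟩) a ha
  · intro γ δ h a ha
    simp only [sub_apply, Complex.sub_re]
    linarith [HermitianPart.le_iff.mp (hy h) a ha]
  · intro f hf hle a ha
    have h1 : p ≤ HermitianPart.ofMem (sub_mem p.val_mem hf) := by
      refine hp.2 ?_
      rintro _ ⟨γ, rfl⟩
      refine HermitianPart.le_iff.mpr fun b hb => ?_
      have := hle γ b hb
      simp only [sub_apply, Complex.sub_re, HermitianPart.val_ofMem] at this ⊢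
      linarith
    have := HermitianPart.le_iff.mp h1 a ha
    simp only [sub_apply, Complex.sub_re, HermitianPart.val_ofMem] at this
    linarith

theorem HermitianPart.tendsto_of_antitone_isGLB (hS : IsClosed (S : Set (StrongDual ℂ A)))
    {Γ : Type*} [Preorder Γ] [Nonempty Γ] [IsDirectedOrder Γ] {z : Γ → HermitianPart S}
    {p : HermitianPart S} (hz : Antitone z) (hp : IsGLB (Set.range z) p) :
    Tendsto z atTop (𝓝 p) := by
  rw [HermitianPart.tendsto_iff]
  refine tendsto_zero_of_antitone_nonneg (Submodule.isClosed_hermitian hS) inf_le_right _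
    (fun γ => sub_mem (z γ).val_mem p.val_mem) ?_ ?_ ?_
  · intro γ a ha
    simpa using HermitianPart.le_iff.mp (hp.1 ⟨γ, rfl⟩) a ha
  · intro γ δ h a ha
    simpa using HermitianPart.le_iff.mp (hz h) a ha
  · intro f hf hle a ha
    have h1 : HermitianPart.ofMem (add_mem p.val_mem hf) ≤ p := by
      refine hp.2 ?_
      rintro _ ⟨γ, rfl⟩
      refine HermitianPart.le_iff.mpr fun b hb => ?_
      have := hle γ b hb
      simp only [sub_apply, add_apply, Complex.sub_re,
        Complex.add_re, HermitianPart.val_ofMem] at this ⊢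
      linarith
    have := HermitianPart.le_iff.mp h1 a ha
    simp only [add_apply, Complex.add_re, HermitianPart.val_ofMem] at this
    linarith

/-- Order convergence implies norm convergence, for nets. -/
theorem OrderConverges.tendsto (hS : IsClosed (S : Set (StrongDual ℂ A)))
    {Γ : Type*} [Preorder Γ] [Nonempty Γ] [IsDirectedOrder Γ] {x : Γ → HermitianPart S}
    {p : HermitianPart S} (h : OrderConverges x p) : Tendsto x atTop (𝓝 p) := by
  obtain ⟨y, z, hyz, ⟨hy, hyp⟩, hz, hzp⟩ := h
  have h1 := HermitianPart.tendsto_of_monotone_isLUB hS hy hyp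
  have h2 := HermitianPart.tendsto_of_antitone_isGLB hS hz hzp
  rw [tendsto_iff_dist_tendsto_zero] at h1 h2 ⊢
  refine squeeze_zero (fun _ => dist_nonneg) (fun γ => ?_)
    (by simpa using (h1.add h2).const_mul 4)
  simp only [HermitianPart.dist_eq_norm]
  refine norm_le_of_forall_nonneg (sub_mem (x γ).2.2 p.2.2) (by positivity) fun a ha => ?_
  have hyx := HermitianPart.le_iff.mp (hyz γ).1 a ha
  have hxz := HermitianPart.le_iff.mp (hyz γ).2 a ha
  have h3 := abs_le.mp (abs_re_apply_le ((y γ).1 - p.1) a)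
  have h4 := abs_le.mp (abs_re_apply_le ((z γ).1 - p.1) a)
  simp only [sub_apply, Complex.sub_re] at h3 h4 ⊢
  have h5 : 0 ≤ ‖(y γ).1 - p.1‖ * ‖a‖ := by positivity
  have h6 : 0 ≤ ‖(z γ).1 - p.1‖ * ‖a‖ := by positivity
  rw [abs_le, add_mul]
  constructor <;> linarith

theorem HermitianPart.le_of_tendsto_le {ι : Type*} {l : Filter ι} [l.NeBot]
    {x y : ι → HermitianPart S} {p q : HermitianPart S} (hx : Tendsto x l (𝓝 p))
    (hy : Tendsto y l (𝓝 q)) (h : ∀ᶠ i in l, x i ≤ y i) : p ≤ q := by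
  have heval : ∀ (a : A) {x : ι → HermitianPart S} {p : HermitianPart S},
      Tendsto x l (𝓝 p) → Tendsto (fun i => ((x i).1 a).re) l (𝓝 (p.1 a).re) := by
    intro a x p hx
    have hc : Continuous fun g : StrongDual ℂ A => (g a).re := by fun_prop
    have hx' : Tendsto (fun i => (x i).1) l (𝓝 p.1) := by
      rw [← tendsto_sub_nhds_zero_iff]
      exact HermitianPart.tendsto_iff.mp hx
    exact (hc.tendsto p.1).comp hx'
  exact HermitianPart.le_iff.mpr fun a ha =>
    le_of_tendsto_of_tendsto (heval a hx) (heval a hy)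
      (h.mono fun i hi => HermitianPart.le_iff.mp hi a ha)

theorem HermitianPart.isLUB_of_tendsto {y : ℕ → HermitianPart S} {p : HermitianPart S}
    (hy : Monotone y) (hp : Tendsto y atTop (𝓝 p)) : IsLUB (Set.range y) p := by
  constructor
  · rintro _ ⟨n, rfl⟩
    exact HermitianPart.le_of_tendsto_le tendsto_const_nhds hp
      ((eventually_ge_atTop n).mono fun m hm => hy hm)
  · intro b hb
    exact HermitianPart.le_of_tendsto_le hp tendsto_const_nhds
      (Eventually.of_forall fun n => hb ⟨n, rfl⟩)

theorem HermitianPart.isGLB_of_tendsto {z : ℕ → HermitianPart S} {p : HermitianPart S}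
    (hz : Antitone z) (hp : Tendsto z atTop (𝓝 p)) : IsGLB (Set.range z) p := by
  constructor
  · rintro _ ⟨n, rfl⟩
    exact HermitianPart.le_of_tendsto_le hp tendsto_const_nhds
      ((eventually_ge_atTop n).mono fun m hm => hz hm)
  · intro b hb
    exact HermitianPart.le_of_tendsto_le tendsto_const_nhds hp
      (Eventually.of_forall fun n => hb ⟨n, rfl⟩)

/-- A net that converges in a metric space converges along some increasing sequence of indices. -/
theorem exists_monotone_seq_tendsto {E : Type*} [PseudoMetricSpace E] {Γ : Type*} [Preorder Γ]
    [Nonempty Γ] [IsDirectedOrder Γ] {x : Γ → E} {p : E} (h : Tendsto x atTop (𝓝 p)) :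
    ∃ γ : ℕ → Γ, Monotone γ ∧ Tendsto (fun n => x (γ n)) atTop (𝓝 p) := by
  have hev : ∀ n : ℕ, ∃ γ₀ : Γ, ∀ γ ≥ γ₀, dist (x γ) p < 1 / (n + 1 : ℝ) := fun n =>
    eventually_atTop.mp ((tendsto_iff_dist_tendsto_zero.mp h).eventually_lt_const (by positivity))
  choose g hg using hev
  obtain ⟨γ, hγ, hgγ⟩ : ∃ γ : ℕ → Γ, Monotone γ ∧ ∀ n, g n ≤ γ n := by
    choose j hj₁ hj₂ using fun a b : Γ => exists_ge_ge a b
    refine ⟨fun n => Nat.rec (g 0) (fun n c => j c (g (n + 1))) n,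
      monotone_nat_of_le_succ fun n => hj₁ _ _, fun n => ?_⟩
    cases n with
    | zero => exact le_rfl
    | succ n => exact hj₂ _ _
  refine ⟨γ, hγ, tendsto_iff_dist_tendsto_zero.mpr ?_⟩
  exact squeeze_zero (fun _ => dist_nonneg) (fun n => (hg n _ (hgγ n)).le)
    tendsto_one_div_add_atTop_nhds_zero_nat

theorem monotoneOrderSeparable_hermitianPart (hS : IsClosed (S : Set (StrongDual ℂ A))) :
    MonotoneOrderSeparable (HermitianPart S) := by
  intro Γ _ _ _ x p
  constructor
  · intro hx hp
    obtain ⟨γ, hγ, hlim⟩ :=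
      exists_monotone_seq_tendsto (HermitianPart.tendsto_of_monotone_isLUB hS hx hp)
    exact ⟨γ, hγ, HermitianPart.isLUB_of_tendsto (hx.comp hγ) hlim⟩
  · intro hx hp
    obtain ⟨γ, hγ, hlim⟩ :=
      exists_monotone_seq_tendsto (HermitianPart.tendsto_of_antitone_isGLB hS hx hp)
    exact ⟨γ, hγ, HermitianPart.isGLB_of_tendsto (hx.comp_monotone hγ) hlim⟩

/-! ### Positive domination and the order topologies -/

/-- Every order-closed set is sequentially order-closed; `ULift ℕ` is the index set of a sequence
in the universe of the poset. -/
theorem IsOrderClosed.isSeqOrderClosed {P : Type u} [PartialOrder P] {X : Set P}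
    (hX : IsOrderClosed X) : IsSeqOrderClosed X := by
  intro x p hx hp
  have : IsDirectedOrder (ULift.{u} ℕ) :=
    ⟨fun a b => ⟨⟨max a.down b.down⟩, le_max_left a.down b.down, le_max_right a.down b.down⟩⟩
  exact hX (ULift.{u} ℕ) (x ∘ ULift.down) p (fun n => hx _)
    (hp.comp_cofinal ULift.down (fun _ _ h => h) fun n => ⟨⟨n⟩, le_rfl⟩)

/-- `S` has positive domination with constant `C` if each hermitian `φ ∈ S` lies below a positive
`p ∈ S` of norm at most `C * ‖φ‖`. -/
def HasPositiveDomination (S : Submodule ℂ (StrongDual ℂ A)) (C : ℝ) : Prop :=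
  ∀ φ ∈ S.hermitian, ∃ p ∈ S.hermitian,
    (∀ a : A, 0 ≤ a → 0 ≤ (p a).re ∧ (φ a).re ≤ (p a).re) ∧ ‖p‖ ≤ C * ‖φ‖

/-- If `‖x n - p‖ ≤ 2⁻ⁿ`, then positive functionals dominating `±(x n - p)` are summable, and the
tails of their sum squeeze `x` to `p` in order. -/
theorem orderConverges_of_dist_le (hS : IsClosed (S : Set (StrongDual ℂ A))) {C : ℝ}
    (hC : HasPositiveDomination S C) {x : ℕ → HermitianPart S} {p : HermitianPart S}
    (h : ∀ n, dist (x n) p ≤ (1 / 2 : ℝ) ^ n) : OrderConverges x p := by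
  have hC' : ∀ φ ∈ S.hermitian, ∃ q ∈ S.hermitian,
      (∀ a : A, 0 ≤ a → 0 ≤ (q a).re ∧ (φ a).re ≤ (q a).re) ∧ ‖q‖ ≤ |C| * ‖φ‖ := by
    intro φ hφ
    obtain ⟨q, hq, h1, h2⟩ := hC φ hφ
    exact ⟨q, hq, h1, h2.trans (by gcongr; exact le_abs_self C)⟩
  choose q hq hqpos hqnorm using fun n => hC' _ (sub_mem (x n).val_mem p.val_mem)
  choose q' hq' hqpos' hqnorm' using fun n => hC' _ (sub_mem p.val_mem (x n).val_mem)
  set r : ℕ → StrongDual ℂ A := fun n => q n + q' n with hr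
  have hrmem : ∀ n, r n ∈ S.hermitian := fun n => add_mem (hq n) (hq' n)
  have hrnorm : ∀ n, ‖r n‖ ≤ 2 * |C| * (1 / 2 : ℝ) ^ n := by
    intro n
    have h1 : |C| * ‖(x n).1 - p.1‖ ≤ |C| * (1 / 2 : ℝ) ^ n := by
      gcongr
      simpa [HermitianPart.dist_eq_norm] using h n
    have h2 := hqnorm' n
    rw [norm_sub_rev] at h2
    have h3 := norm_add_le (q n) (q' n)
    have h4 := hqnorm n
    simp only [hr]
    linarith
  have hsum : Summable r := Summable.of_norm_bounded
    (summable_geometric_two.mul_left (2 * |C|)) hrnorm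
  have hrpos : ∀ n, ∀ a : A, 0 ≤ a → 0 ≤ (r n a).re := by
    intro n a ha
    simp only [hr, add_apply, Complex.add_re]
    linarith [(hqpos n a ha).1, (hqpos' n a ha).1]
  set R : ℕ → StrongDual ℂ A := fun n => (∑' k, r k) - ∑ k ∈ Finset.range n, r k with hR
  have hclosed := Submodule.isClosed_hermitian hS
  have hpartial : ∀ n, ∑ k ∈ Finset.range n, r k ∈ S.hermitian := fun n =>
    sum_mem fun k _ => hrmem k
  have hRmem : ∀ n, R n ∈ S.hermitian := fun n =>
    sub_mem (hclosed.mem_of_tendsto hsum.hasSum.tendsto_sum_nat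
      (Eventually.of_forall hpartial)) (hpartial n)
  have hRlim : Tendsto R atTop (𝓝 0) := by
    have := (tendsto_const_nhds (x := ∑' k, r k)).sub hsum.hasSum.tendsto_sum_nat
    rwa [sub_self] at this
  have hRsucc : ∀ n, ∀ a : A, (R n a).re = (R (n + 1) a).re + (r n a).re := by
    intro n a
    have : R n = R (n + 1) + r n := by
      simp only [hR, Finset.sum_range_succ]
      abel
    rw [this, add_apply, Complex.add_re]
  have hRanti : ∀ a : A, 0 ≤ a → Antitone fun n => (R n a).re := by
    intro a ha
    refine antitone_nat_of_succ_le fun n => ?_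
    linarith [hrpos n a ha, hRsucc n a]
  have hRpos : ∀ n, ∀ a : A, 0 ≤ a → 0 ≤ (R n a).re := by
    intro n a ha
    have hc : Continuous fun g : StrongDual ℂ A => (g a).re := by fun_prop
    have hlim : Tendsto (fun n => (R n a).re) atTop (𝓝 0) := by
      exact (hc.tendsto 0).comp hRlim
    exact (hRanti a ha).le_of_tendsto hlim n
  have hRr : ∀ n, ∀ a : A, 0 ≤ a → (r n a).re ≤ (R n a).re := by
    intro n a ha
    linarith [hRpos (n + 1) a ha, hRsucc n a]
  have hyanti : Monotone fun n => HermitianPart.ofMem (sub_mem p.val_mem (hRmem n)) := by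
    intro m n hmn
    refine HermitianPart.le_iff.mpr fun a ha => ?_
    simp only [HermitianPart.val_ofMem, sub_apply, Complex.sub_re]
    linarith [hRanti a ha hmn]
  have hzanti : Antitone fun n => HermitianPart.ofMem (add_mem p.val_mem (hRmem n)) := by
    intro m n hmn
    refine HermitianPart.le_iff.mpr fun a ha => ?_
    simpa using hRanti a ha hmn
  refine ⟨_, _, fun n => ⟨?_, ?_⟩, ⟨hyanti, HermitianPart.isLUB_of_tendsto hyanti ?_⟩,
    hzanti, HermitianPart.isGLB_of_tendsto hzanti ?_⟩
  · refine HermitianPart.le_iff.mpr fun a ha => ?_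
    have h1 := hRr n a ha
    have h2 := (hqpos' n a ha).2
    have h3 := (hqpos n a ha).1
    simp only [hr, HermitianPart.val_ofMem, sub_apply,
      add_apply, Complex.sub_re, Complex.add_re] at h1 h2 ⊢
    linarith
  · refine HermitianPart.le_iff.mpr fun a ha => ?_
    have h1 := hRr n a ha
    have h2 := (hqpos n a ha).2
    have h3 := (hqpos' n a ha).1
    simp only [hr, HermitianPart.val_ofMem, sub_apply,
      add_apply, Complex.sub_re, Complex.add_re] at h1 h2 ⊢
    linarith
  · rw [HermitianPart.tendsto_iff]
    simpa using hRlim.neg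
  · rw [HermitianPart.tendsto_iff]
    simpa using hRlim

/-- Positive domination makes norm-closed, order-closed and sequentially order-closed sets
coincide. -/
theorem orderTopologies_eq_of_hasPositiveDomination (hS : IsClosed (S : Set (StrongDual ℂ A)))
    {C : ℝ} (hC : HasPositiveDomination S C) :
    normTopology S = netOrderTopology (HermitianPart S) ∧
      netOrderTopology (HermitianPart S) = seqOrderTopology (HermitianPart S) ∧
      MonotoneOrderSeparable (HermitianPart S) := by
  have h₁ : ∀ X : Set (HermitianPart S), IsClosed X → IsOrderClosed X :=
    fun X hX Γ _ _ _ x p hx hp => hX.mem_of_tendsto (hp.tendsto hS) (Eventually.of_forall hx)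
  have h₃ : ∀ X : Set (HermitianPart S), IsSeqOrderClosed X → IsClosed X := by
    intro X hX
    refine isClosed_of_closure_subset fun p hp => ?_
    choose x hxX hx using fun n : ℕ =>
      Metric.mem_closure_iff.mp hp ((1 / 2 : ℝ) ^ n) (by positivity)
    exact hX x p hxX (orderConverges_of_dist_le hS hC fun n => by
      rw [dist_comm]
      exact (hx n).le)
  have hnet : ∀ X : Set (HermitianPart S),
      IsClosed[netOrderTopology (HermitianPart S)] X ↔ IsOrderClosed X :=
    fun X => by
      refine (@isOpen_compl_iff _ X (netOrderTopology (HermitianPart S))).symm.trans ?_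
      change Xᶜᶜ ∈ {X : Set (HermitianPart S) | IsOrderClosed X} ↔ _
      rw [compl_compl, Set.mem_ofPred_eq]
  have hseq : ∀ X : Set (HermitianPart S),
      IsClosed[seqOrderTopology (HermitianPart S)] X ↔ IsSeqOrderClosed X :=
    fun X => by
      refine (@isOpen_compl_iff _ X (seqOrderTopology (HermitianPart S))).symm.trans ?_
      change Xᶜᶜ ∈ {X : Set (HermitianPart S) | IsSeqOrderClosed X} ↔ _
      rw [compl_compl, Set.mem_ofPred_eq]
  refine ⟨TopologicalSpace.ext_isClosed fun X => ?_, TopologicalSpace.ext_isClosed fun X => ?_,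
    monotoneOrderSeparable_hermitianPart hS⟩
  · rw [hnet]
    exact ⟨h₁ X, fun h => h₃ X h.isSeqOrderClosed⟩
  · rw [hnet, hseq]
    exact ⟨fun h => h.isSeqOrderClosed, fun h => h₁ X (h₃ X h)⟩

end Nonunital

/-! ### Domination in the dual of a C*-algebra -/

section Hermitization

variable {A : Type u} [NonUnitalCStarAlgebra A]

/-- The adjoint functional `a ↦ conj (f (star a))`. -/
noncomputable def conjStar (f : StrongDual ℂ A) : StrongDual ℂ A :=
  LinearMap.mkContinuous
    { toFun := fun a => starRingEnd ℂ (f (star a))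
      map_add' := fun a b => by simp
      map_smul' := fun c a => by simp }
    ‖f‖ fun a => by
      simpa using f.le_opNorm (star a)

@[simp]
theorem conjStar_apply (f : StrongDual ℂ A) (a : A) :
    conjStar f a = starRingEnd ℂ (f (star a)) := rfl

/-- The hermitian part `(f + f*) / 2` of a functional. -/
noncomputable def hermitize (f : StrongDual ℂ A) : StrongDual ℂ A :=
  (1 / 2 : ℂ) • (f + conjStar f)

theorem hermitize_apply_of_isSelfAdjoint (f : StrongDual ℂ A) {a : A} (ha : IsSelfAdjoint a) :
    hermitize f a = (f a).re := by
  simp only [hermitize, smul_apply, add_apply, conjStar_apply, ha.star_eq,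
    Complex.add_conj, smul_eq_mul]
  push_cast
  ring

theorem hermitize_mem_hermitianFunctionals (f : StrongDual ℂ A) :
    hermitize f ∈ hermitianFunctionals A := fun a ha => by
  rw [hermitize_apply_of_isSelfAdjoint f ha, Complex.ofReal_im]

variable [PartialOrder A] [StarOrderedRing A]

theorem re_hermitize_apply_of_nonneg (f : StrongDual ℂ A) {a : A} (ha : 0 ≤ a) :
    (hermitize f a).re = (f a).re := by
  rw [hermitize_apply_of_isSelfAdjoint f ha.isSelfAdjoint, Complex.ofReal_re]

/-- The separation argument for the full dual: a positive functional dominating `φ` is the slope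
of a hyperplane between the ray `{0} × [0, ∞)` and the open convex set of pairs `(a₁ + a₂ - c, s)`
with `a₁, a₂ ≥ 0`, `‖c‖ < 2` and `s < φ a₁ - 2 * ‖φ‖`. -/
theorem hasPositiveDomination_top :
    HasPositiveDomination (⊤ : Submodule ℂ (StrongDual ℂ A)) 8 := by
  intro φ _
  obtain ⟨N, hN⟩ : ∃ N, N = 2 * ‖φ‖ := ⟨_, rfl⟩
  have hN0 : 0 ≤ N := by rw [hN]; positivity
  set D : Set (A × ℝ) :=
    {z | ∃ a₁ a₂ : A, 0 ≤ a₁ ∧ 0 ≤ a₂ ∧ ‖a₁ + a₂ - z.1‖ < 2 ∧ z.2 < (φ a₁).re - N} with hD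
  have hDopen : IsOpen D := by
    have : D = ⋃ (a₁ : A) (a₂ : A) (_ : 0 ≤ a₁) (_ : 0 ≤ a₂),
        {z : A × ℝ | ‖a₁ + a₂ - z.1‖ < 2 ∧ z.2 < (φ a₁).re - N} := by
      ext z
      simp only [hD, Set.mem_ofPred_eq, Set.mem_iUnion, exists_prop]
    rw [this]
    refine isOpen_iUnion fun a₁ => isOpen_iUnion fun a₂ => isOpen_iUnion fun _ =>
      isOpen_iUnion fun _ => IsOpen.inter ?_ ?_
    · exact isOpen_lt (f := fun z : A × ℝ => ‖a₁ + a₂ - z.1‖) (by fun_prop) continuous_const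
    · exact isOpen_lt (f := fun z : A × ℝ => z.2) (by fun_prop) continuous_const
  have hDconv : Convex ℝ D := by
    rintro z ⟨a₁, a₂, ha₁, ha₂, hz1, hz2⟩ z' ⟨a₁', a₂', ha₁', ha₂', hz1', hz2'⟩ s t hs ht hst
    refine ⟨s • a₁ + t • a₁', s • a₂ + t • a₂', add_nonneg (smul_nonneg hs ha₁)
      (smul_nonneg ht ha₁'), add_nonneg (smul_nonneg hs ha₂) (smul_nonneg ht ha₂'), ?_, ?_⟩
    · have h := convex_ball (0 : A) 2 (mem_ball_zero_iff.mpr hz1) (mem_ball_zero_iff.mpr hz1')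
        hs ht hst
      rw [mem_ball_zero_iff] at h
      refine lt_of_eq_of_lt (congrArg norm ?_) h
      change s • a₁ + t • a₁' + (s • a₂ + t • a₂') - (s • z.1 + t • z'.1) = _
      simp only [smul_sub, smul_add]
      abel
    · have h := convex_Ioi (0 : ℝ) (Set.mem_Ioi.mpr (sub_pos.mpr hz2))
        (Set.mem_Ioi.mpr (sub_pos.mpr hz2')) hs ht hst
      have h1 : φ (s • a₁ + t • a₁') = s • φ a₁ + t • φ a₁' := by
        rw [map_add]
        exact congrArg₂ _ (map_real_smul φ φ.continuous _ _) (map_real_smul φ φ.continuous _ _)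
      rw [h1]
      simp only [smul_eq_mul, Set.mem_Ioi, Complex.add_re, Complex.real_smul,
        Complex.re_ofReal_mul, Prod.snd_add, Prod.smul_snd] at h ⊢
      have h2 : s * N + t * N = N := by rw [← add_mul, hst, one_mul]
      linarith
  have hdisj : Disjoint D ({0} ×ˢ Set.Ici 0) := by
    rw [Set.disjoint_left]
    rintro ⟨x, r⟩ ⟨a₁, a₂, ha₁, ha₂, h1, h2⟩ ⟨hx, hr⟩
    obtain rfl : x = 0 := hx
    have h3 : ‖a₁‖ ≤ ‖a₁ + a₂‖ :=
      CStarAlgebra.norm_le_norm_of_nonneg_of_le ha₁ (le_add_of_nonneg_right ha₂)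
    have h4 := (abs_le.mp (abs_re_apply_le φ a₁)).2
    have h5 : (0 : ℝ) ≤ r := hr
    dsimp only at h1 h2
    rw [sub_zero] at h1
    have h6 : ‖φ‖ * ‖a₁‖ ≤ ‖φ‖ * 2 := by gcongr; linarith
    linarith
  obtain ⟨f, b, hfD, hfray⟩ := geometric_hahn_banach_open hDconv hDopen
    ((convex_singleton _).prod (convex_Ici _)) hdisj
  have hf : ∀ x r, f (x, r) = f (x, 0) + r * f (0, 1) := by
    intro x r
    have : (x, r) = (x, (0 : ℝ)) + r • ((0 : A), (1 : ℝ)) := by simp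
    rw [this, map_add, map_smul, smul_eq_mul]
  have hb : b ≤ 0 := by
    have := hfray (0, 0) ⟨rfl, Set.self_mem_Ici⟩
    rwa [← Prod.zero_eq_mk, map_zero] at this
  have hk : 0 < f (0, 1) := by
    have h1 := hfD (0, -N - 1) ⟨0, 0, le_rfl, le_rfl, by simp, by simp⟩
    rw [hf, ← Prod.zero_eq_mk, map_zero, zero_add] at h1
    nlinarith
  set k := f (0, 1) with hkdef
  set g : StrongDual ℝ A := -(k⁻¹ • f.comp (ContinuousLinearMap.inl ℝ A ℝ)) with hg
  have hgf : ∀ x, f (x, 0) = -(k * g x) := by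
    intro x
    simp [hg, hk.ne']
  have hmain : ∀ a₁ a₂ c : A, 0 ≤ a₁ → 0 ≤ a₂ → ‖c‖ < 2 →
      (φ a₁).re - N ≤ g (a₁ + a₂ - c) := by
    intro a₁ a₂ c ha₁ ha₂ hc
    refine le_of_forall_lt fun s hs => ?_
    have h1 := hfD (a₁ + a₂ - c, s) ⟨a₁, a₂, ha₁, ha₂, by simpa using hc, hs⟩
    rw [hf, hgf] at h1
    have h2 : k * (s - g (a₁ + a₂ - c)) < 0 := by linarith
    linarith [neg_of_mul_neg_right h2 hk.le]
  -- A real-linear function bounded below on a cone is nonnegative there.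
  have hscale : ∀ r : ℝ, (∀ t : ℝ, 0 ≤ t → -N ≤ t * r) → 0 ≤ r := by
    intro r hr
    by_contra! hneg
    have h1 := hr ((N + 1) / -r) (div_nonneg (by positivity) (by linarith))
    have h2 : (N + 1) / -r * r = -(N + 1) := by
      have := hneg.ne
      field_simp
    linarith
  have hgpos : ∀ a : A, 0 ≤ a → 0 ≤ g a := by
    intro a ha
    refine hscale _ fun t ht => ?_
    simpa using hmain 0 (t • a) 0 le_rfl (smul_nonneg ht ha) (by simp)
  have hgφ : ∀ a : A, 0 ≤ a → (φ a).re ≤ g a := by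
    intro a ha
    rw [← sub_nonneg]
    refine hscale _ fun t ht => ?_
    have h1 := hmain (t • a) 0 0 (smul_nonneg ht ha) le_rfl (by simp)
    have h2 : φ (t • a) = t • φ a := map_real_smul φ φ.continuous _ _
    rw [h2, add_zero, sub_zero, map_smul, smul_eq_mul, Complex.real_smul,
      Complex.re_ofReal_mul] at h1
    linarith
  have hgnorm : ‖g‖ ≤ N := by
    refine g.opNorm_le_of_unit_norm hN0 fun c hc => ?_
    have hball : ∀ c : A, ‖c‖ = 1 → g c ≤ N := by
      intro c hc
      have := hmain 0 0 c le_rfl le_rfl (by rw [hc]; norm_num)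
      simp only [map_zero, Complex.zero_re, zero_sub, add_zero, map_neg] at this
      linarith
    rw [Real.norm_eq_abs, abs_le']
    exact ⟨hball c hc, by simpa using hball (-c) (by simpa using hc)⟩
  have hre : ∀ a : A, (g.extendRCLike (𝕜 := ℂ) a).re = g a := fun a => by
    simp [StrongDual.extendRCLike_apply]
  refine ⟨hermitize (g.extendRCLike (𝕜 := ℂ)),
    ⟨Submodule.mem_top, hermitize_mem_hermitianFunctionals _⟩, fun a ha => ?_, ?_⟩
  · rw [re_hermitize_apply_of_nonneg _ ha, hre]
    exact ⟨hgpos a ha, hgφ a ha⟩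
  · rw [show 8 * ‖φ‖ = 4 * N by rw [hN]; ring]
    refine norm_le_of_forall_nonneg (hermitize_mem_hermitianFunctionals _) hN0 fun a ha => ?_
    rw [re_hermitize_apply_of_nonneg _ ha, hre, ← Real.norm_eq_abs]
    exact (g.le_opNorm a).trans (by gcongr)

end Hermitization

/-! ### Norm characterizations of self-adjoint and positive elements -/

section Unital

variable {M : Type u} [CStarAlgebra M]

theorem norm_add_mul_I_smul_one_le {a : M} {r : ℝ} (ha : IsSelfAdjoint a) (har : ‖a‖ ≤ r)
    (t : ℝ) :
    ‖a + (t * Complex.I) • (1 : M)‖ ≤ √(r ^ 2 + t ^ 2) := by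
  have hone : ‖(1 : M)‖ ≤ 1 := by
    nontriviality M
    exact CStarRing.norm_one.le
  refine Real.le_sqrt_of_sq_le ?_
  rw [sq, ← CStarRing.norm_star_mul_self]
  have : star (a + (t * Complex.I) • (1 : M)) * (a + (t * Complex.I) • (1 : M)) =
      a * a + ((t : ℂ) ^ 2) • (1 : M) := by
    simp only [star_add, star_smul, star_one, ha.star_eq, Complex.star_def, map_mul,
      Complex.conj_I, Complex.conj_ofReal, add_mul, mul_add, smul_mul_assoc, one_mul,
      mul_smul_comm, mul_one]
    have : (t * Complex.I) * (t * -Complex.I) = (t : ℂ) ^ 2 := by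
      linear_combination (-(t : ℂ) ^ 2) * Complex.I_sq
    rw [smul_add, smul_smul, this]
    module
  rw [this]
  refine (norm_add_le _ _).trans (add_le_add ?_ ?_)
  · rw [sq]
    exact (norm_mul_le _ _).trans
      (mul_le_mul har har (norm_nonneg _) ((norm_nonneg _).trans har))
  · rw [norm_smul, norm_pow, Complex.norm_real, Real.norm_eq_abs, sq_abs]
    exact mul_le_of_le_one_right (sq_nonneg t) hone

/-- The estimate forces the imaginary part `b` of `a` to vanish: `b + t ≤ √(r² + t²)`, and
`√(r² + t²) - t` tends to zero as `t → ∞`, so `b ≤ 0`; negative `t` give `-b ≤ 0`. -/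
theorem isSelfAdjoint_of_norm_add_mul_I_smul_one_le {a : M} {r : ℝ}
    (h : ∀ t : ℝ, ‖a + (t * Complex.I) • (1 : M)‖ ≤ √(r ^ 2 + t ^ 2)) : IsSelfAdjoint a := by
  let _ := CStarAlgebra.spectralOrder M
  let _ := CStarAlgebra.spectralOrderedRing M
  have him : ∀ t : ℝ, imaginaryPart (a + (t * Complex.I) • (1 : M)) =
      imaginaryPart a + t • (1 : selfAdjoint M) := by
    intro t
    have h1 : imaginaryPart (1 : M) = 0 := (IsSelfAdjoint.one M).imaginaryPart
    have h2 : realPart (1 : M) = (1 : selfAdjoint M) :=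
      Subtype.ext (IsSelfAdjoint.one M).coe_realPart
    simp [imaginaryPart_smul, h1, h2]
  have hnorm : ∀ t : ℝ, ‖(imaginaryPart a : M) + t • (1 : M)‖ ≤ √(r ^ 2 + t ^ 2) := by
    intro t
    refine le_trans ?_ (h t)
    have := imaginaryPart.norm_le (a + (t * Complex.I) • (1 : M))
    rw [him] at this
    exact this
  have hlim : Tendsto (fun t : ℝ => √(r ^ 2 + t ^ 2) - t) atTop (𝓝 0) := by
    refine squeeze_zero' (g := fun t : ℝ => r ^ 2 * t⁻¹)
      (Eventually.of_forall fun t => ?_) ?_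
      (by simpa using tendsto_inv_atTop_zero.const_mul (r ^ 2))
    · rw [sub_nonneg]
      exact Real.le_sqrt_of_sq_le (by linarith [sq_nonneg r])
    · filter_upwards [eventually_gt_atTop 0] with t ht
      rw [sub_le_iff_le_add]
      refine Real.sqrt_le_iff.mpr ⟨by positivity, ?_⟩
      have : t⁻¹ * t = 1 := inv_mul_cancel₀ ht.ne'
      nlinarith [sq_nonneg (r ^ 2 * t⁻¹)]
  have key : ∀ b : M, IsSelfAdjoint b →
      (∀ t : ℝ, ‖b + t • (1 : M)‖ ≤ √(r ^ 2 + t ^ 2)) → b ≤ 0 := by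
    intro b hb hbt
    have h1 : ∀ t : ℝ, b ≤ (√(r ^ 2 + t ^ 2) - t) • (1 : M) := by
      intro t
      have hsa : IsSelfAdjoint (b + t • (1 : M)) := hb.add ((IsSelfAdjoint.all t).smul (.one M))
      have h2 : b + t • (1 : M) ≤ √(r ^ 2 + t ^ 2) • (1 : M) := by
        refine hsa.le_algebraMap_norm_self.trans ?_
        rw [Algebra.algebraMap_eq_smul_one]
        exact smul_le_smul_of_nonneg_right (hbt t) (zero_le_one (α := M))
      rw [sub_smul]
      exact le_sub_iff_add_le.mpr h2
    refine ge_of_tendsto (x := atTop) (f := fun t : ℝ => (√(r ^ 2 + t ^ 2) - t) • (1 : M)) ?_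
      (Eventually.of_forall h1)
    simpa using hlim.smul_const (1 : M)
  have h1 := key _ (imaginaryPart a).2 hnorm
  have h2 := key (-(imaginaryPart a : M)) (imaginaryPart a).2.neg fun t => by
    have := hnorm (-t)
    rw [← norm_neg] at this
    simpa [add_comm] using this
  have h3 : (imaginaryPart a : M) = 0 := le_antisymm h1 (by simpa using h2)
  rw [← realPart_add_I_smul_imaginaryPart a, h3]
  simp

theorem isSelfAdjoint_and_norm_le_iff {a : M} {r : ℝ} (hr : 0 ≤ r) :
    IsSelfAdjoint a ∧ ‖a‖ ≤ r ↔ ∀ t : ℝ, ‖a + (t * Complex.I) • (1 : M)‖ ≤ √(r ^ 2 + t ^ 2) :=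
  ⟨fun h => norm_add_mul_I_smul_one_le h.1 h.2, fun h =>
    ⟨isSelfAdjoint_of_norm_add_mul_I_smul_one_le h, by simpa [Real.sqrt_sq hr] using h 0⟩⟩

theorem nonneg_iff_norm_algebraMap_sub_le [PartialOrder M] [StarOrderedRing M] {a : M} {r : ℝ}
    (ha : IsSelfAdjoint a) (har : ‖a‖ ≤ r) : 0 ≤ a ↔ ‖algebraMap ℝ M r - a‖ ≤ r := by
  lift r to NNReal using (norm_nonneg a).trans har
  have h := SpectrumRestricts.nnreal_iff_nnnorm (a := a) (t := r) ha har
  rw [nonneg_iff_isSelfAdjoint_and_quasispectrumRestricts, and_iff_right ha]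
  exact h

end Unital

/-! ### Functionals on a dual space that are evaluations -/

section Dual

variable {X : Type v} [NormedAddCommGroup X] [NormedSpace ℂ X] [CompleteSpace X]

/-- A functional on a dual space that is small on unit vectors annihilated by suitable
finite sets of points is itself evaluation at a point: by Hahn-Banach it is at distance at most
`ε` from the span of the finite set, and the evaluations form a closed subspace. -/
theorem exists_eq_inclusionInDoubleDual_of_small {f : StrongDual ℂ (StrongDual ℂ X)}
    (h : ∀ ε > 0, ∃ F : Finset X, ∀ φ : StrongDual ℂ X, ‖φ‖ ≤ 1 → (∀ x ∈ F, φ x = 0) →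
      ‖f φ‖ ≤ ε) : ∃ x : X, ∀ φ, f φ = φ x := by
  have hclosed : IsClosed (Set.range (NormedSpace.inclusionInDoubleDualLi (E := X) ℂ)) :=
    (NormedSpace.inclusionInDoubleDualLi (E := X)
      ℂ).isometry.isUniformInducing.isComplete_range.isClosed
  suffices hf : f ∈ Set.range (NormedSpace.inclusionInDoubleDualLi (E := X) ℂ) by
    obtain ⟨x, rfl⟩ := hf
    exact ⟨x, fun φ => rfl⟩
  rw [← hclosed.closure_eq]
  refine (Metric.mem_closure_iff (α := StrongDual ℂ (StrongDual ℂ X))).mpr fun ε hε => ?_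
  obtain ⟨F, hF⟩ := h (ε / 2) (by positivity)
  let J := NormedSpace.inclusionInDoubleDual ℂ X
  let N : Submodule ℂ (StrongDual ℂ X) := ⨅ x : F, LinearMap.ker (J x.1).toLinearMap
  have hN : ∀ φ ∈ N, ∀ x ∈ F, φ x = 0 := by
    intro φ hφ x hx
    exact (Submodule.mem_iInf _).mp hφ ⟨x, hx⟩
  obtain ⟨g, hgf, hg⟩ := exists_extension_norm_eq N (f.comp N.subtypeL)
  have hgnorm : ‖g‖ ≤ ε / 2 := by
    rw [hg]
    refine ContinuousLinearMap.opNorm_le_of_unit_norm (𝕜 := ℂ) (by positivity) fun φ hφ => ?_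
    exact hF φ.1 hφ.le (hN φ.1 φ.2)
  have hspan : (f - g).toLinearMap ∈
      Submodule.span ℂ (Set.range fun x : F => (J x.1).toLinearMap) := by
    refine mem_span_of_iInf_ker_le_ker fun φ hφ => ?_
    have := hgf ⟨φ, hφ⟩
    simp only [LinearMap.mem_ker]
    exact sub_eq_zero.mpr this.symm
  have hsub : ∃ x : X, J x = f - g := by
    have hle : Submodule.span ℂ (Set.range fun x : F => (J x.1).toLinearMap) ≤
        LinearMap.range ((ContinuousLinearMap.coeLM ℂ).comp J.toLinearMap) := by
      refine Submodule.span_le.mpr ?_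
      rintro _ ⟨x, rfl⟩
      exact ⟨x.1, rfl⟩
    obtain ⟨x, hx⟩ := hle hspan
    exact ⟨x, ContinuousLinearMap.coe_injective hx⟩
  obtain ⟨x, hx⟩ := hsub
  refine ⟨J x, ⟨x, rfl⟩, ?_⟩
  have hxg : f - J x = g := by
    rw [hx]
    exact sub_sub_cancel f g
  refine ((dist_eq_norm f (J x)).trans (congrArg norm hxg)).trans_lt ?_
  linarith

end Dual

/-! ### Weak-* compactness and normal functionals -/

section Predual

variable {M : Type u} [CStarAlgebra M] {X : Type v} [NormedAddCommGroup X] [NormedSpace ℂ X]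
  (e : StrongDual ℂ X ≃ₗᵢ[ℂ] M)

/-- Evaluation at a point of the predual, as a functional on `M`. -/
noncomputable def normalFunctional (x : X) : StrongDual ℂ M :=
  (NormedSpace.inclusionInDoubleDual ℂ X x).comp (e.symm : M →L[ℂ] StrongDual ℂ X)

@[simp]
theorem normalFunctional_apply (x : X) (a : M) : normalFunctional e x a = e.symm a x := rfl

theorem mem_vonNeumannPredual_iff {f : StrongDual ℂ M} :
    f ∈ vonNeumannPredual e ↔ ∃ x : X, f = normalFunctional e x := by
  constructor
  · rintro ⟨x, hx⟩
    refine ⟨x, ContinuousLinearMap.ext fun a => ?_⟩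
    rw [normalFunctional_apply, ← hx, e.apply_symm_apply]
  · rintro ⟨x, rfl⟩
    exact ⟨x, fun φ => by simp⟩

theorem isClosed_vonNeumannPredual [CompleteSpace X] :
    IsClosed (vonNeumannPredual e : Set (StrongDual ℂ M)) := by
  have hiso : Isometry (normalFunctional e) := by
    refine Isometry.of_dist_eq fun x y => ?_
    have h1 : normalFunctional e x - normalFunctional e y = normalFunctional e (x - y) := by
      ext a
      simp
    rw [dist_eq_norm, dist_eq_norm, h1, normalFunctional]
    exact (ContinuousLinearMap.opNorm_comp_linearIsometryEquiv _ e.symm).trans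
      ((NormedSpace.inclusionInDoubleDualLi (E := X) ℂ).norm_map (x - y))
  have : (vonNeumannPredual e : Set (StrongDual ℂ M)) = Set.range (normalFunctional e) := by
    ext f
    rw [SetLike.mem_coe, mem_vonNeumannPredual_iff]
    exact exists_congr fun x => eq_comm
  rw [this]
  exact hiso.isUniformInducing.isComplete_range.isClosed

theorem isClosed_norm_sub_le (b : M) (r : ℝ) :
    IsClosed {φ : WeakDual ℂ X | ‖e φ.toStrongDual - b‖ ≤ r} := by
  have : {φ : WeakDual ℂ X | ‖e φ.toStrongDual - b‖ ≤ r} =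
      WeakDual.toStrongDual ⁻¹' Metric.closedBall (e.symm b) r := by
    ext φ
    rw [Set.mem_preimage, mem_closedBall_iff_norm, ← e.norm_map, map_sub, e.apply_symm_apply]
    rfl
  rw [this]
  exact WeakDual.isClosed_closedBall _ _

theorem isCompact_norm_le (r : ℝ) :
    IsCompact {φ : WeakDual ℂ X | ‖e φ.toStrongDual‖ ≤ r} := by
  have : {φ : WeakDual ℂ X | ‖e φ.toStrongDual‖ ≤ r} =
      WeakDual.toStrongDual ⁻¹' Metric.closedBall 0 r := by
    ext φ
    simp
  rw [this]
  exact WeakDual.isCompact_closedBall _ _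

/-- The self-adjoint part of a ball is weak-* compact, as an intersection of balls. -/
theorem isCompact_isSelfAdjoint_norm_le {r : ℝ} (hr : 0 ≤ r) :
    IsCompact {φ : WeakDual ℂ X | IsSelfAdjoint (e φ.toStrongDual) ∧ ‖e φ.toStrongDual‖ ≤ r} := by
  refine (isCompact_norm_le e r).of_isClosed_subset ?_ fun φ h => h.2
  simp only [isSelfAdjoint_and_norm_le_iff hr, Set.ofPred_forall]
  refine isClosed_iInter fun t => ?_
  simpa using isClosed_norm_sub_le e (-((t * Complex.I) • (1 : M))) (√(r ^ 2 + t ^ 2))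

/-- The positive part of a ball is weak-* compact. -/
theorem isCompact_nonneg_norm_le [PartialOrder M] [StarOrderedRing M] {r : ℝ} (hr : 0 ≤ r) :
    IsCompact {φ : WeakDual ℂ X | 0 ≤ e φ.toStrongDual ∧ ‖e φ.toStrongDual‖ ≤ r} := by
  have : {φ : WeakDual ℂ X | 0 ≤ e φ.toStrongDual ∧ ‖e φ.toStrongDual‖ ≤ r} =
      {φ : WeakDual ℂ X | IsSelfAdjoint (e φ.toStrongDual) ∧ ‖e φ.toStrongDual‖ ≤ r} ∩
        {φ : WeakDual ℂ X | ‖e φ.toStrongDual - algebraMap ℝ M r‖ ≤ r} := by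
    ext φ
    constructor
    · rintro ⟨h0, h1⟩
      refine ⟨⟨h0.isSelfAdjoint, h1⟩, ?_⟩
      rw [Set.mem_ofPred_eq, norm_sub_rev]
      exact (nonneg_iff_norm_algebraMap_sub_le h0.isSelfAdjoint h1).mp h0
    · rintro ⟨⟨h0, h1⟩, h2⟩
      rw [Set.mem_ofPred_eq, norm_sub_rev] at h2
      exact ⟨(nonneg_iff_norm_algebraMap_sub_le h0 h1).mpr h2, h1⟩
  rw [this]
  exact (isCompact_isSelfAdjoint_norm_le e hr).inter_right (isClosed_norm_sub_le e _ r)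

/-- The adjoint of a normal functional is normal. On the unit ball the adjoint operation is
weak-* continuous at zero because the self-adjoint part of the ball is compact. -/
theorem conjStar_mem_vonNeumannPredual [CompleteSpace X] {f : StrongDual ℂ M}
    (hf : f ∈ vonNeumannPredual e) : conjStar f ∈ vonNeumannPredual e := by
  obtain ⟨x, rfl⟩ := (mem_vonNeumannPredual_iff e).mp hf
  set B : Set (WeakDual ℂ X) :=
    {φ | IsSelfAdjoint (e φ.toStrongDual) ∧ ‖e φ.toStrongDual‖ ≤ 1} with hB
  suffices h : ∃ y : X, ∀ φ, (conjStar (normalFunctional e x)).comp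
      (e : StrongDual ℂ X →L[ℂ] M) φ = φ y from h
  refine exists_eq_inclusionInDoubleDual_of_small fun ε hε => ?_
  have hcompact : IsCompact ((B ×ˢ B) ∩ {p : WeakDual ℂ X × WeakDual ℂ X |
      ε ≤ ‖p.1 x - Complex.I * p.2 x‖}) := by
    refine ((isCompact_isSelfAdjoint_norm_le e zero_le_one).prod
      (isCompact_isSelfAdjoint_norm_le e zero_le_one)).inter_right (isClosed_le continuous_const ?_)
    exact (((WeakDual.eval_continuous x).comp continuous_fst).sub
      (continuous_const.mul ((WeakDual.eval_continuous x).comp continuous_snd))).norm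
  obtain ⟨F, hF⟩ := hcompact.elim_finite_subfamily_closed
    (fun y : X => {p : WeakDual ℂ X × WeakDual ℂ X | p.1 y + Complex.I * p.2 y = 0})
    (fun y => isClosed_eq (((WeakDual.eval_continuous y).comp continuous_fst).add
      (continuous_const.mul ((WeakDual.eval_continuous y).comp continuous_snd)))
      continuous_const) (by
    rw [Set.eq_empty_iff_forall_notMem]
    rintro ⟨h, k⟩ ⟨⟨⟨⟨hh, -⟩, hk, -⟩, hε'⟩, hzero⟩
    simp only [Set.mem_iInter, Set.mem_ofPred_eq] at hzero hε'
    have hsum : h.toStrongDual + Complex.I • k.toStrongDual = 0 :=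
      ContinuousLinearMap.ext hzero
    have hsum' : e h.toStrongDual + Complex.I • e k.toStrongDual = 0 := by
      rw [← map_smul, ← map_add, hsum, map_zero]
    have hre := congrArg (fun a : M => (realPart a : M)) hsum'
    have him := congrArg (fun a : M => (imaginaryPart a : M)) hsum'
    simp [realPart_I_smul, imaginaryPart_I_smul, hh.coe_realPart, hk.coe_realPart,
      hh.imaginaryPart, hk.imaginaryPart] at hre him
    have h1 : h x = 0 := congrArg (fun g : StrongDual ℂ X => g x) hre
    have h2 : k x = 0 := congrArg (fun g : StrongDual ℂ X => g x) him
    rw [h1, h2] at hε'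
    simp at hε'
    linarith)
  refine ⟨F, fun φ hφ hφF => ?_⟩
  by_contra! hlt
  set h : WeakDual ℂ X := (e.symm (realPart (e φ) : M)).toWeakDual with hh
  set k : WeakDual ℂ X := (e.symm (imaginaryPart (e φ) : M)).toWeakDual with hk
  have hsum : ∀ y, φ y = h y + Complex.I * k y := by
    intro y
    have h1 : φ = e.symm (realPart (e φ) : M) + Complex.I • e.symm (imaginaryPart (e φ) : M) := by
      rw [← map_smul, ← map_add, realPart_add_I_smul_imaginaryPart, e.symm_apply_apply]
    conv_lhs => rw [h1]
    rfl
  have hstar : e.symm (star (e φ)) x = h x - Complex.I * k x := by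
    have h1 : star (e φ) = (realPart (e φ) : M) - Complex.I • (imaginaryPart (e φ) : M) := by
      conv_lhs => rw [← realPart_add_I_smul_imaginaryPart (e φ)]
      simp [sub_eq_add_neg]
    rw [h1, map_sub, map_smul]
    rfl
  have heh : e h.toStrongDual = (realPart (e φ) : M) := e.apply_symm_apply _
  have hek : e k.toStrongDual = (imaginaryPart (e φ) : M) := e.apply_symm_apply _
  refine Set.eq_empty_iff_forall_notMem.mp hF (h, k) ⟨⟨⟨⟨?_, ?_⟩, ?_, ?_⟩, ?_⟩, ?_⟩
  · exact heh ▸ (realPart (e φ)).2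
  · rw [heh]
    exact (realPart.norm_le (e φ)).trans ((e.norm_map φ).trans_le hφ)
  · exact hek ▸ (imaginaryPart (e φ)).2
  · rw [hek]
    exact (imaginaryPart.norm_le (e φ)).trans ((e.norm_map φ).trans_le hφ)
  · rw [Set.mem_ofPred_eq, ← hstar]
    refine hlt.le.trans_eq ?_
    exact Complex.norm_conj _
  · simp only [Set.mem_iInter, Set.mem_ofPred_eq]
    exact fun y hy => by rw [← hsum, hφF y hy]

theorem hermitize_mem_hermitian_vonNeumannPredual [CompleteSpace X] {f : StrongDual ℂ M}
    (hf : f ∈ vonNeumannPredual e) : hermitize f ∈ (vonNeumannPredual e).hermitian :=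
  ⟨Submodule.smul_mem _ _ (add_mem hf (conjStar_mem_vonNeumannPredual e hf)),
    hermitize_mem_hermitianFunctionals f⟩

end Predual

/-! ### Domination in the predual of a von Neumann algebra -/

section Separation

/-- Let `K` and `B` be compact convex sets containing zero. If `φ h₁ + ψ h₂ < R` whenever
`h₁, h₂ ∈ K` and `h₁ + h₂ ∈ B`, then a continuous functional `g` satisfies
`φ h₁ + ψ h₂ - R ≤ g h₁ + g h₂ - g c` for all `h₁, h₂ ∈ K` and `c ∈ B`: it is the slope of a
hyperplane that separates the compact convex set of pairs `(h₁ + h₂ - c, φ h₁ + ψ h₂)` from the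
ray `{0} × [R, ∞)`. -/
theorem exists_functional_of_forall_add_lt {E : Type*} [AddCommGroup E] [Module ℝ E]
    [TopologicalSpace E] [IsTopologicalAddGroup E] [ContinuousSMul ℝ E] [LocallyConvexSpace ℝ E]
    [T1Space E] {K B : Set E} (hK : IsCompact K) (hKconv : Convex ℝ K) (hB : IsCompact B)
    (hBconv : Convex ℝ B) (hK0 : 0 ∈ K) (hB0 : 0 ∈ B) {φ ψ : StrongDual ℝ E} {R : ℝ}
    (hR : 0 < R) (h : ∀ h₁ ∈ K, ∀ h₂ ∈ K, h₁ + h₂ ∈ B → φ h₁ + ψ h₂ < R) :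
    ∃ g : StrongDual ℝ E, ∀ h₁ ∈ K, ∀ h₂ ∈ K, ∀ c ∈ B,
      φ h₁ + ψ h₂ - R ≤ g h₁ + g h₂ - g c := by
  let p₁ : E × E × E →L[ℝ] E := ContinuousLinearMap.fst ℝ E (E × E)
  let p₂ : E × E × E →L[ℝ] E :=
    (ContinuousLinearMap.fst ℝ E E).comp (ContinuousLinearMap.snd ℝ E (E × E))
  let p₃ : E × E × E →L[ℝ] E :=
    (ContinuousLinearMap.snd ℝ E E).comp (ContinuousLinearMap.snd ℝ E (E × E))
  let L : E × E × E →L[ℝ] E × ℝ := (p₁ + p₂ - p₃).prod (φ.comp p₁ + ψ.comp p₂)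
  have hL : ∀ h₁ h₂ c, L (h₁, h₂, c) = (h₁ + h₂ - c, φ h₁ + ψ h₂) := fun _ _ _ => rfl
  have hDconv : Convex ℝ (L '' (K ×ˢ K ×ˢ B)) :=
    (hKconv.prod (hKconv.prod hBconv)).linear_image (L : E × E × E →ₗ[ℝ] E × ℝ)
  have hDcomp : IsCompact (L '' (K ×ˢ K ×ˢ B)) := (hK.prod (hK.prod hB)).image L.continuous
  have hdisj : Disjoint (L '' (K ×ˢ K ×ˢ B)) ({0} ×ˢ Set.Ici R) := by
    rw [Set.disjoint_left]
    rintro _ ⟨⟨h₁, h₂, c⟩, ⟨hh₁, hh₂, hc⟩, rfl⟩ ⟨h0, hge⟩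
    replace h0 : h₁ + h₂ - c = 0 := h0
    replace hge : R ≤ φ h₁ + ψ h₂ := hge
    rw [sub_eq_zero] at h0
    exact (h h₁ hh₁ h₂ hh₂ (h0 ▸ hc)).not_ge hge
  obtain ⟨f, u, v, hfD, huv, hfray⟩ := geometric_hahn_banach_compact_closed hDconv hDcomp
    ((convex_singleton _).prod (convex_Ici _)) (isClosed_singleton.prod isClosed_Ici) hdisj
  have hf : ∀ x r, f (x, r) = f (x, 0) + r * f (0, 1) := by
    intro x r
    have : (x, r) = (x, (0 : ℝ)) + r • ((0 : E), (1 : ℝ)) := by simp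
    rw [this, map_add, map_smul, smul_eq_mul]
  have hu : 0 < u := by
    have := hfD 0 ⟨0, ⟨hK0, hK0, hB0⟩, map_zero L⟩
    rwa [map_zero] at this
  have hvk : v < R * f (0, 1) := by
    have := hfray (0, R) ⟨rfl, Set.self_mem_Ici⟩
    rwa [hf, ← Prod.zero_eq_mk, map_zero, zero_add] at this
  have hk : 0 < f (0, 1) := pos_of_mul_pos_right ((hu.trans huv).trans hvk) hR.le
  refine ⟨-((f (0, 1))⁻¹ • f.comp (ContinuousLinearMap.inl ℝ E ℝ)), ?_⟩
  intro h₁ hh₁ h₂ hh₂ c hc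
  have h1 := hfD _ ⟨(h₁, h₂, c), ⟨hh₁, hh₂, hc⟩, rfl⟩
  rw [hL, hf] at h1
  set k := f (0, 1)
  set g : StrongDual ℝ E := -(k⁻¹ • f.comp (ContinuousLinearMap.inl ℝ E ℝ)) with hg
  have hgf : f (h₁ + h₂ - c, 0) = -(k * g (h₁ + h₂ - c)) := by
    simp [hg, hk.ne']
  rw [hgf] at h1
  rw [← map_add, ← map_sub]
  refine le_of_mul_le_mul_left ?_ hk
  linarith

end Separation

section Predual

variable {M : Type u} [CStarAlgebra M] {X : Type v} [NormedAddCommGroup X] [NormedSpace ℂ X]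
  (e : StrongDual ℂ X ≃ₗᵢ[ℂ] M)

instance WeakDual.isScalarTower_real_complex : IsScalarTower ℝ ℂ (WeakDual ℂ X) :=
  inferInstanceAs (IsScalarTower ℝ ℂ (X →L[ℂ] ℂ))

instance WeakDual.locallyConvexSpace_real : LocallyConvexSpace ℝ (WeakDual ℂ X) :=
  inferInstanceAs (LocallyConvexSpace ℝ (WeakBilin (topDualPairing ℂ X)))

/-- A real-linear weak-* continuous functional on the dual of `X` is the real part of the
evaluation at a point of `X`. -/
theorem exists_re_apply_eq (g : StrongDual ℝ (WeakDual ℂ X)) :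
    ∃ x : X, ∀ φ : WeakDual ℂ X, (φ x).re = g φ := by
  obtain ⟨x, hx⟩ := LinearMap.dualEmbedding_surjective (topDualPairing ℂ X)
    (g.extendRCLike (𝕜 := ℂ))
  refine ⟨x, fun φ => ?_⟩
  have h1 : φ x = g.extendRCLike (𝕜 := ℂ) φ := by
    rw [← hx]
    rfl
  rw [h1]
  simp [StrongDual.extendRCLike_apply]

/-- The real part of evaluation at a point, as a weak-* continuous real functional. -/
noncomputable def reEval (x : X) : StrongDual ℝ (WeakDual ℂ X) where
  toFun φ := (φ x).re
  map_add' _ _ := rfl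
  map_smul' c φ := by
    change (c • φ x).re = c * (φ x).re
    simp
  cont := Complex.continuous_re.comp (WeakDual.eval_continuous x)

@[simp]
theorem reEval_apply (x : X) (φ : WeakDual ℂ X) : reEval x φ = (φ x).re := rfl

theorem apply_real_smul_add_smul (s t : ℝ) (φ ψ : WeakDual ℂ X) :
    e (s • φ + t • ψ).toStrongDual = s • e φ.toStrongDual + t • e ψ.toStrongDual := by
  rw [← map_real_smul e e.continuous, ← map_real_smul e e.continuous, ← map_add]
  rfl

theorem convex_norm_le (r : ℝ) : Convex ℝ {φ : WeakDual ℂ X | ‖e φ.toStrongDual‖ ≤ r} := by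
  intro φ hφ ψ hψ s t hs ht hst
  have := convex_closedBall (0 : M) r (mem_closedBall_zero_iff.mpr hφ)
    (mem_closedBall_zero_iff.mpr hψ) hs ht hst
  rw [mem_closedBall_zero_iff] at this
  rwa [Set.mem_ofPred_eq, apply_real_smul_add_smul]

/-- A bound on the contractions in a cone `C` extends to the whole cone by homogeneity. -/
theorem le_mul_norm_of_forall_norm_le_one {f : StrongDual ℂ M} {C : M → Prop}
    (hC : ∀ (t : ℝ) (a : M), 0 ≤ t → C a → C (t • a)) {r : ℝ}
    (h : ∀ a, C a → ‖a‖ ≤ 1 → (f a).re ≤ r) (a : M) (ha : C a) : (f a).re ≤ r * ‖a‖ := by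
  rcases eq_or_ne a 0 with rfl | h0
  · simp
  · have hpos : 0 < ‖a‖ := norm_pos_iff.mpr h0
    have h1 := h (‖a‖⁻¹ • a) (hC _ _ (by positivity) ha) (by
      rw [norm_smul, norm_inv, norm_norm, inv_mul_cancel₀ hpos.ne'])
    have h2 : f (‖a‖⁻¹ • a) = ‖a‖⁻¹ • f a := map_real_smul f f.continuous _ _
    rw [h2, Complex.real_smul, Complex.re_ofReal_mul, inv_mul_le_iff₀ hpos] at h1
    linarith

variable [PartialOrder M] [StarOrderedRing M]

theorem convex_nonneg_norm_le (r : ℝ) :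
    Convex ℝ {φ : WeakDual ℂ X | 0 ≤ e φ.toStrongDual ∧ ‖e φ.toStrongDual‖ ≤ r} := by
  intro φ hφ ψ hψ s t hs ht hst
  refine ⟨?_, convex_norm_le e r hφ.2 hψ.2 hs ht hst⟩
  rw [apply_real_smul_add_smul]
  exact add_nonneg (smul_nonneg hs hφ.1) (smul_nonneg ht hψ.1)

/-- The separation theorem for the positive part of the ball of radius `n` and the unit ball, in the
weak-* topology. If `a₁, a₂ ≥ 0` and `‖a₁ + a₂‖ ≤ 1`, then `‖a₁‖, ‖a₂‖ ≤ 1`, so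
`x a₁ + y a₂ ≤ 2 * N < 3 * N` for normal functionals `x`, `y` bounded by `N` on positive
contractions. -/
theorem exists_normalFunctional_separating {x y : X} {N n : ℝ} (hN : 0 < N) (hn : 0 ≤ n)
    (hx : ∀ a : M, 0 ≤ a → (normalFunctional e x a).re ≤ N * ‖a‖)
    (hy : ∀ a : M, 0 ≤ a → (normalFunctional e y a).re ≤ N * ‖a‖) :
    ∃ z : X, ∀ a₁ a₂ c : M, 0 ≤ a₁ → ‖a₁‖ ≤ n → 0 ≤ a₂ → ‖a₂‖ ≤ n → ‖c‖ ≤ 1 →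
      (normalFunctional e x a₁).re + (normalFunctional e y a₂).re - 3 * N ≤
        (normalFunctional e z a₁).re + (normalFunctional e z a₂).re -
          (normalFunctional e z c).re := by
  have hlt : ∀ h₁ ∈ {φ : WeakDual ℂ X | 0 ≤ e φ.toStrongDual ∧ ‖e φ.toStrongDual‖ ≤ n},
      ∀ h₂ ∈ {φ : WeakDual ℂ X | 0 ≤ e φ.toStrongDual ∧ ‖e φ.toStrongDual‖ ≤ n},
      h₁ + h₂ ∈ {φ : WeakDual ℂ X | ‖e φ.toStrongDual‖ ≤ 1} →
      reEval x h₁ + reEval y h₂ < 3 * N := by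
    rintro h₁ ⟨hpos₁, -⟩ h₂ ⟨hpos₂, -⟩ hsum
    rw [Set.mem_ofPred_eq, map_add, map_add] at hsum
    have hle₁ : ‖e h₁.toStrongDual‖ ≤ 1 :=
      (CStarAlgebra.norm_le_norm_of_nonneg_of_le hpos₁ (le_add_of_nonneg_right hpos₂)).trans hsum
    have hle₂ : ‖e h₂.toStrongDual‖ ≤ 1 :=
      (CStarAlgebra.norm_le_norm_of_nonneg_of_le hpos₂ (le_add_of_nonneg_left hpos₁)).trans hsum
    have hb₁ := hx _ hpos₁
    have hb₂ := hy _ hpos₂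
    rw [normalFunctional_apply, e.symm_apply_apply, WeakDual.toStrongDual_apply] at hb₁ hb₂
    rw [reEval_apply, reEval_apply]
    have h1 := mul_le_of_le_one_right hN.le hle₁
    have h2 := mul_le_of_le_one_right hN.le hle₂
    linarith
  have key := exists_functional_of_forall_add_lt (E := WeakDual ℂ X)
    (K := {φ | 0 ≤ e φ.toStrongDual ∧ ‖e φ.toStrongDual‖ ≤ n})
    (B := {φ | ‖e φ.toStrongDual‖ ≤ 1}) (φ := reEval x) (ψ := reEval y) (R := 3 * N)
  obtain ⟨g, hg⟩ := key (isCompact_nonneg_norm_le e hn)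
    (convex_nonneg_norm_le e n) (isCompact_norm_le e 1)
    (convex_norm_le e 1) (by simpa using hn) (by simp) (by positivity) hlt
  obtain ⟨z, hz⟩ := exists_re_apply_eq g
  refine ⟨z, fun a₁ a₂ c h₁ h₁' h₂ h₂' hc => ?_⟩
  have happ : ∀ a : M, e (e.symm a).toWeakDual.toStrongDual = a := e.apply_symm_apply
  have key := hg (e.symm a₁).toWeakDual ⟨(happ a₁).symm ▸ h₁, (happ a₁).symm ▸ h₁'⟩
    (e.symm a₂).toWeakDual ⟨(happ a₂).symm ▸ h₂, (happ a₂).symm ▸ h₂'⟩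
    (e.symm c).toWeakDual ((congrArg norm (happ c)).trans_le hc)
  rwa [← hz, ← hz, ← hz] at key

/-- Simultaneous domination of two normal functionals by a normal functional, up to `ε`. -/
theorem exists_approx_domination [CompleteSpace X] {φ ψ : StrongDual ℂ M}
    (hφ : φ ∈ vonNeumannPredual e) (hψ : ψ ∈ vonNeumannPredual e) {N ε : ℝ} (hN : 0 < N)
    (hε : 0 < ε) (hφN : ∀ a : M, 0 ≤ a → (φ a).re ≤ N * ‖a‖)
    (hψN : ∀ a : M, 0 ≤ a → (ψ a).re ≤ N * ‖a‖) :
    ∃ p ∈ (vonNeumannPredual e).hermitian, ‖p‖ ≤ 12 * N ∧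
      ∀ a : M, 0 ≤ a → ((φ - p) a).re ≤ ε * ‖a‖ ∧ ((ψ - p) a).re ≤ ε * ‖a‖ := by
  obtain ⟨x, rfl⟩ := (mem_vonNeumannPredual_iff e).mp hφ
  obtain ⟨y, rfl⟩ := (mem_vonNeumannPredual_iff e).mp hψ
  -- The error `3 * N` of the separation theorem is `ε * n` on the ball of radius `n`.
  obtain ⟨n, hn⟩ : ∃ n : ℝ, n = 3 * N / ε := ⟨_, rfl⟩
  have hn0 : 0 < n := by rw [hn]; positivity
  have hnε : n * ε = 3 * N := by
    rw [hn]
    field_simp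
  obtain ⟨z, hz⟩ := exists_normalFunctional_separating e hN hn0.le hφN hψN
  have hlow : ∀ a : M, 0 ≤ a → ‖a‖ ≤ 1 →
      ((normalFunctional e x - normalFunctional e z) a).re ≤ ε ∧
      ((normalFunctional e y - normalFunctional e z) a).re ≤ ε := by
    intro a ha ha1
    have hna : 0 ≤ n • a := smul_nonneg hn0.le ha
    have hna1 : ‖n • a‖ ≤ n := by
      rw [norm_smul, Real.norm_of_nonneg hn0.le]
      exact mul_le_of_le_one_right hn0.le ha1
    have hre : ∀ w : X, (normalFunctional e w (n • a)).re = n * (normalFunctional e w a).re := by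
      intro w
      rw [map_real_smul _ (normalFunctional e w).continuous, Complex.real_smul,
        Complex.re_ofReal_mul]
    have h1 := hz (n • a) 0 0 hna hna1 le_rfl (by simpa using hn0.le) (by simp)
    have h2 := hz 0 (n • a) 0 le_rfl (by simpa using hn0.le) hna hna1 (by simp)
    simp only [hre, map_zero, Complex.zero_re, add_zero, zero_add, sub_zero] at h1 h2
    simp only [sub_apply, Complex.sub_re]
    constructor
    · refine le_of_mul_le_mul_left ?_ hn0
      linarith
    · refine le_of_mul_le_mul_left ?_ hn0
      linarith
  have hup : ∀ a : M, ‖a‖ ≤ 1 → (normalFunctional e z a).re ≤ 3 * N := by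
    intro a ha1
    have h1 := hz 0 0 a le_rfl (by simpa using hn0.le) le_rfl (by simpa using hn0.le) ha1
    simp only [map_zero, Complex.zero_re, add_zero, zero_sub] at h1
    linarith
  have hcone : ∀ (t : ℝ) (a : M), 0 ≤ t → 0 ≤ a → 0 ≤ t • a := fun t a ht ha => smul_nonneg ht ha
  have hupall : ∀ a, (normalFunctional e z a).re ≤ 3 * N * ‖a‖ := fun a =>
    le_mul_norm_of_forall_norm_le_one (C := fun _ => True) (fun _ _ _ _ => trivial)
      (fun a _ => hup a) a trivial
  refine ⟨hermitize (normalFunctional e z), hermitize_mem_hermitian_vonNeumannPredual e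
    ((mem_vonNeumannPredual_iff e).mpr ⟨z, rfl⟩), ?_, fun a ha => ⟨?_, ?_⟩⟩
  · rw [show 12 * N = 4 * (3 * N) by ring]
    refine norm_le_of_forall_nonneg (hermitize_mem_hermitianFunctionals _) (by positivity)
      fun a ha => ?_
    rw [re_hermitize_apply_of_nonneg _ ha, abs_le']
    exact ⟨hupall a, by simpa using hupall (-a)⟩
  · have := le_mul_norm_of_forall_norm_le_one hcone (fun a ha ha1 => (hlow a ha ha1).1) a ha
    rwa [sub_apply, Complex.sub_re, re_hermitize_apply_of_nonneg _ ha, ← Complex.sub_re,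
      ← sub_apply]
  · have := le_mul_norm_of_forall_norm_le_one hcone (fun a ha ha1 => (hlow a ha ha1).2) a ha
    rwa [sub_apply, Complex.sub_re, re_hermitize_apply_of_nonneg _ ha, ← Complex.sub_re,
      ← sub_apply]

/-- Exact domination by a normal functional, summing approximate corrections of geometrically
decreasing norm. -/
theorem hasPositiveDomination_vonNeumannPredual [CompleteSpace X] :
    HasPositiveDomination (vonNeumannPredual e) 24 := by
  intro φ hφ
  rcases eq_or_ne φ 0 with rfl | hφ0
  · exact ⟨0, zero_mem _, fun a _ => by simp, by simp⟩
  have hN : 0 < ‖φ‖ := norm_pos_iff.mpr hφ0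
  -- A partial sum that dominates `φ` and `0` up to `‖φ‖ / 2 ^ k`.
  let Good : ℕ → StrongDual ℂ M → Prop := fun k p => p ∈ (vonNeumannPredual e).hermitian ∧
    ∀ a : M, 0 ≤ a → ((φ - p) a).re ≤ ‖φ‖ * (1 / 2) ^ k * ‖a‖ ∧
      ((-p) a).re ≤ ‖φ‖ * (1 / 2) ^ k * ‖a‖
  have hstep : ∀ k p, Good k p → ∃ p', Good (k + 1) p' ∧
      dist p p' ≤ 12 * ‖φ‖ * (1 / 2) ^ k := by
    rintro k p ⟨hp, hpa⟩
    obtain ⟨q, hq, hqnorm, hqa⟩ := exists_approx_domination e (φ := φ - p) (ψ := -p)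
      (N := ‖φ‖ * (1 / 2) ^ k) (ε := ‖φ‖ * (1 / 2) ^ (k + 1))
      (sub_mem hφ.1 hp.1) (neg_mem hp.1) (by positivity) (by positivity)
      (fun a ha => (hpa a ha).1) (fun a ha => (hpa a ha).2)
    refine ⟨p + q, ⟨add_mem hp hq, fun a ha => ?_⟩, ?_⟩
    · rw [← sub_sub, neg_add, ← sub_eq_add_neg]
      exact hqa a ha
    · rw [dist_eq_norm, sub_add_cancel_left, norm_neg]
      linarith
  choose! step hgood hdist using hstep
  let P : ℕ → StrongDual ℂ M := fun k => Nat.rec 0 step k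
  have hP : ∀ k, Good k (P k) := by
    intro k
    induction k with
    | zero =>
      refine ⟨zero_mem _, fun a _ => ⟨?_, ?_⟩⟩
      · simpa [P] using (le_abs_self _).trans (abs_re_apply_le φ a)
      · simp [P]
        positivity
    | succ k ih => exact hgood k _ ih
  have hPdist : ∀ k, dist (P k) (P (k + 1)) ≤ 12 * ‖φ‖ * (1 / 2) ^ k := fun k =>
    hdist k _ (hP k)
  obtain ⟨p, hp⟩ := cauchySeq_tendsto_of_complete
    (cauchySeq_of_le_geometric (1 / 2) (12 * ‖φ‖) (by norm_num) hPdist)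
  have hlim : ∀ a : M, Tendsto (fun k : ℕ => ‖φ‖ * (1 / 2) ^ k * ‖a‖) atTop (𝓝 0) := by
    intro a
    simpa using ((tendsto_pow_atTop_nhds_zero_of_lt_one (r := (1 / 2 : ℝ)) (by norm_num)
      (by norm_num)).const_mul ‖φ‖).mul_const ‖a‖
  refine ⟨p, (Submodule.isClosed_hermitian (isClosed_vonNeumannPredual e)).mem_of_tendsto hp
    (Eventually.of_forall fun k => (hP k).1), fun a ha => ⟨?_, ?_⟩, ?_⟩
  · have hc : Continuous fun g : StrongDual ℂ M => ((-g) a).re := by fun_prop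
    have h1 : ((-p) a).re ≤ 0 := le_of_tendsto_of_tendsto ((hc.tendsto p).comp hp) (hlim a)
      (Eventually.of_forall fun k => ((hP k).2 a ha).2)
    simpa using h1
  · have hc : Continuous fun g : StrongDual ℂ M => ((φ - g) a).re := by
      simp only [sub_apply]
      fun_prop
    have h1 : ((φ - p) a).re ≤ 0 := le_of_tendsto_of_tendsto ((hc.tendsto p).comp hp) (hlim a)
      (Eventually.of_forall fun k => ((hP k).2 a ha).1)
    simpa using h1
  · have h1 := dist_le_of_le_geometric_of_tendsto₀ (1 / 2) (12 * ‖φ‖) (by norm_num) hPdist hp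
    have h2 : dist (P 0) p = ‖p‖ := dist_zero_left p
    rw [h2] at h1
    exact h1.trans_eq (by ring)

end Predual

theorem mainTheorem3 :
    (∀ (M : Type u) [CStarAlgebra M] (X : Type v) [NormedAddCommGroup X] [NormedSpace ℂ X]
      [CompleteSpace X] (e : StrongDual ℂ X ≃ₗᵢ[ℂ] M),
      normTopology (vonNeumannPredual e) =
          netOrderTopology (HermitianPart (vonNeumannPredual e)) ∧
        netOrderTopology (HermitianPart (vonNeumannPredual e)) =
          seqOrderTopology (HermitianPart (vonNeumannPredual e)) ∧
        MonotoneOrderSeparable (HermitianPart (vonNeumannPredual e))) ∧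
    (∀ (A : Type w) [NonUnitalCStarAlgebra A],
      normTopology (⊤ : Submodule ℂ (StrongDual ℂ A)) =
          netOrderTopology (HermitianPart (⊤ : Submodule ℂ (StrongDual ℂ A))) ∧
        netOrderTopology (HermitianPart (⊤ : Submodule ℂ (StrongDual ℂ A))) =
          seqOrderTopology (HermitianPart (⊤ : Submodule ℂ (StrongDual ℂ A))) ∧
        MonotoneOrderSeparable (HermitianPart (⊤ : Submodule ℂ (StrongDual ℂ A)))) := by
  constructor
  · intro M _ X _ _ _ e
    let _ := CStarAlgebra.spectralOrder M
    let _ := CStarAlgebra.spectralOrderedRing M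
    exact orderTopologies_eq_of_hasPositiveDomination (isClosed_vonNeumannPredual e)
      (hasPositiveDomination_vonNeumannPredual e)
  · intro A _
    let _ := CStarAlgebra.spectralOrder A
    let _ := CStarAlgebra.spectralOrderedRing A
    exact orderTopologies_eq_of_hasPositiveDomination isClosed_univ hasPositiveDomination_top
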